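/- Let $m$ be an odd prime, let $q=2^m$, and let $\mathbf F_q$ be the field with $q$ elements. Let $\mathcal E$ be the set of lines of $\mathrm{PG}(2,q)$ that contain no point of the conic $\{(\xi,\xi^2,1)\mid \xi\in\mathbf F_q\}\cup\{(0,1,0)\}$; each such line has the form $(1,x,y)^\perp=\{(a_0,a_1,a_2)\mid a_0+a_1x+a_2y=0\}$. For $a\in\mathbf F_q$ let $\Gamma_a$ be the set of pairs of lines $((1,x,y)^\perp,(1,z,u)^\perp)$ in $\mathcal E\times\mathcal E$ with $x^2u^2+y^2z^2+(x+z)(y+u)=a$, and let $\Delta_a=\bigcup_{i\ge 0}\Gamma_{a^{2^i}}$. Let $\mathcal S$ consist of the diagonal of $\mathcal E\times\mathcal E$ and of the relations $\Delta_a$, where $a$ runs through the nonzero elements of $\mathbf F_q$ with $\mathrm{Tr}_{\mathbf F_q/\mathbf F_2}(a)=0$ (equal relations being counted once). Then $(\mathcal E,\mathcal S)$ is a symmetric association scheme, and it is pseudocyclic, that is, all primitive idempotents of its Bose–Mesner algebra (the real algebra generated by the adjacency matrices of the relations) other than $\frac1{|\mathcal E|}J$, where $J$ is the all-one matrix, have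 the same rank. Moreover, let $G$ be the graph with vertex set $\mathcal E\times\mathcal E$ in which two distinct vertices $(\ell_1,\ell_2)$ and $(\ell_1',\ell_2')$ are adjacent if and only if $(\ell_1,\ell_1')$ and $(\ell_2,\ell_2')$ lie in the same nondiagonal relation of $\mathcal S$. Then $G$ is a strongly regular graph of Latin square type with parameters $$\Bigl(\tfrac14 q^2(q-1)^2,\; m(q+1)\bigl(\tfrac{q(q-1)}2-1\bigr),\; \lambda,\; \mu\Bigr),$$ where $\lambda=\frac{q(q-1)}2+m^2(q+1)^2-3m(q+1)$ and $\mu=m^2(q+1)^2-m(q+1)$. In particular, a Latin square type strongly regular graph with these parameters exists. Here a strongly regular graph with parameters $(v,k,\lambda,\mu)$ is of Latin square type if $(v,k,\lambda,\mu)=(n^2,\,t(n-1),\,n+t^2-3t,\,t^2-t)$ for some integers $n,t$ with $1\le t\le n+1$. -/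

import Mathlib

noncomputable section

/-! ### Association schemes and pseudocyclicity -/

section Schemes

variable {X : Type*} [Fintype X]

open Classical in
/-- A (symmetric) association scheme on a finite set `X`, given as its set `S` of relations:
`S` is a partition of `X × X`, the diagonal is one of the relations, all relations are symmetric,
and the intersection parameters exist. -/
structure IsAssociationScheme (S : Set (Set (X × X))) : Prop where
  isPartition : Setoid.IsPartition S
  diagonal_mem : Set.diagonal X ∈ S
  symm : ∀ R ∈ S, ∀ x y : X, (x, y) ∈ R → (y, x) ∈ R
  intersection : ∀ A ∈ S, ∀ B ∈ S, ∀ C ∈ S, ∃ p : ℕ, ∀ x y : X, (x, y) ∈ C →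
    (Finset.univ.filter fun z : X => (x, z) ∈ A ∧ (z, y) ∈ B).card = p

open Classical in
/-- The adjacency matrix of a relation. -/
def relMatrix (R : Set (X × X)) : Matrix X X ℝ :=
  Matrix.of fun x y => if (x, y) ∈ R then 1 else 0

open Classical in
/-- The Bose-Mesner algebra: the real algebra generated by the adjacency matrices. -/
def boseMesner (S : Set (Set (X × X))) : Subalgebra ℝ (Matrix X X ℝ) :=
  Algebra.adjoin ℝ (relMatrix '' S)

/-- The primitive idempotents of the Bose-Mesner algebra: the nonzero idempotents that lie above
no idempotent of the algebra but `0` and themselves. -/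
def IsPrimitiveIdempotentOf (S : Set (Set (X × X))) (E : Matrix X X ℝ) : Prop :=
  E ∈ boseMesner S ∧ E * E = E ∧ E ≠ 0 ∧
    ∀ F ∈ boseMesner S, F * F = F → E * F = F → F * E = F → F = 0 ∨ F = E

/-- An association scheme is pseudocyclic if all its nontrivial multiplicities, that is, the ranks
of the primitive idempotents other than `|X|⁻¹ J`, are equal. -/
def IsPseudocyclic (S : Set (Set (X × X))) : Prop :=
  IsAssociationScheme S ∧ ∃ t : ℕ, ∀ E : Matrix X X ℝ, IsPrimitiveIdempotentOf S E →
    E ≠ (Fintype.card X : ℝ)⁻¹ • Matrix.of (fun _ _ => (1 : ℝ)) → E.rank = t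

/-- The product graph on `X × X`: distinct `(x, y)` and `(x', y')` are adjacent if and only if
`(x, x')` and `(y, y')` lie in the same nondiagonal relation of `S`. (`SimpleGraph.fromRel` imposes
distinctness and symmetrizes; for symmetric relations the latter changes nothing.) -/
def productGraph (S : Set (Set (X × X))) : SimpleGraph (X × X) :=
  SimpleGraph.fromRel fun p p' =>
    ∃ R ∈ S, R ≠ Set.diagonal X ∧ (p.1, p'.1) ∈ R ∧ (p.2, p'.2) ∈ R

end Schemes

open Classical in
/-- `G` is a strongly regular graph with parameters `(v, k, l, μ)`, of Latin square type:
`(v, k, l, μ) = (n ^ 2, t (n - 1), n + t ^ 2 - 3 t, t ^ 2 - t)` with `1 ≤ t ≤ n + 1`. -/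
def IsLatinSquareTypeSRG {V : Type*} [Fintype V] (G : SimpleGraph V) (v k l μ : ℕ) : Prop :=
  G.IsSRGWith v k l μ ∧ ∃ n t : ℕ, 1 ≤ t ∧ t ≤ n + 1 ∧
    (v : ℤ) = n ^ 2 ∧ (k : ℤ) = t * (n - 1) ∧ (l : ℤ) = n + t ^ 2 - 3 * t ∧ (μ : ℤ) = t ^ 2 - t

/-! ### The fusion scheme on the exterior lines to a conic -/

section Elliptic

variable (F : Type*) [Field F]

/-- The conic `{(ξ, ξ², 1)} ∪ {(0, 1, 0)}` in `PG(2, F)`. -/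
def conic : Set (Projectivization F (Fin 3 → F)) :=
  {P | (∃ ξ : F, P.submodule = Submodule.span F {![ξ, ξ ^ 2, 1]}) ∨
    P.submodule = Submodule.span F {![0, 1, 0]}}

/-- The exterior lines: the lines of `PG(2, F)` that contain no point of the conic. -/
def ExteriorLine : Type _ :=
  {ℓ : Submodule F (Fin 3 → F) // Module.finrank F ℓ = 2 ∧ ∀ P ∈ conic F, ¬ P.submodule ≤ ℓ}

instance [Finite F] : Fintype (ExteriorLine F) :=
  @Fintype.ofFinite _ (Subtype.finite)

variable {F}

/-- The line `(1, x, y)^⊥ = {(a₀, a₁, a₂) | a₀ + a₁ x + a₂ y = 0}`. -/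
def perpLine (x y : F) : Submodule F (Fin 3 → F) where
  carrier := {a | a 0 + a 1 * x + a 2 * y = 0}
  add_mem' {a b} ha hb := by
    simp only [Set.mem_ofPred_eq, Pi.add_apply] at *
    linear_combination ha + hb
  zero_mem' := by simp
  smul_mem' c a ha := by
    simp only [Set.mem_ofPred_eq, Pi.smul_apply, smul_eq_mul] at *
    linear_combination c * ha

/-- `Γ_a`: the pairs of exterior lines `(1, x, y)^⊥`, `(1, z, u)^⊥` with
`x² u² + y² z² + (x + z) (y + u) = a`. -/
def ellipticRel (a : F) : Set (ExteriorLine F × ExteriorLine F) :=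
  {p | ∃ x y z u : F, p.1.val = perpLine x y ∧ p.2.val = perpLine z u ∧
    x ^ 2 * u ^ 2 + y ^ 2 * z ^ 2 + (x + z) * (y + u) = a}

/-- `Δ_a`: the union of the `Γ_b`, where `b` runs through the orbit `{a, a², a⁴, …}` of `a` under
the Frobenius automorphism. -/
def fusionRel (a : F) : Set (ExteriorLine F × ExteriorLine F) :=
  ⋃ i : ℕ, ellipticRel (a ^ 2 ^ i)

variable (F) in
/-- The fusion scheme: its relations are the diagonal and the `Δ_a`, where `a` runs through the
nonzero elements of trace `0`. (Elements of one Frobenius orbit give the same relation.) -/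
def fusionScheme [Algebra (ZMod 2) F] : Set (Set (ExteriorLine F × ExteriorLine F)) :=
  insert (Set.diagonal (ExteriorLine F))
    {R | ∃ a : F, a ≠ 0 ∧ Algebra.trace (ZMod 2) F a = 0 ∧ R = fusionRel a}

end Elliptic

end

set_option linter.unusedSectionVars false

/-! In characteristic two the line `(1, x, y)^⊥` is exterior exactly when `Tr(xy) = 1`, that is,
when the binary form `Q(s,t) = x s² + st + y t²` is anisotropic. The quantity defining `Γ_a` is the
resultant `ρ` of two such forms; its trace is 0, and it vanishes only on the diagonal.

Let `P_c(x,y)` (`proportionalCount`) count the points of the projective line where the form of `x`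
is `c` times that of `y`. For `c ≠ 1` it equals `1 - (-1)^Tr(ρ/(1+c)²)`, so the `P_c` are, up to
affine change, all additive characters evaluated at `ρ`. Double counting gives `P_c P_d =
(q/2)(P_{cd} + P_{d/c}) + (q(q+1)/2) J` for nonzero `c`, `d` (`sum_proportionalCount_mul`). By
Fourier inversion the relations `Γ_a` have intersection numbers, and each nondiagonal one with
`Tr(a) = 0` has valency `q + 1`. Since Frobenius acts on the points, its orbits fuse to a scheme; as
`m` is prime and `Tr(1) = 1`, the nonzero orbits of trace 0 have size `m`, so the valencies are `k =
m(q+1)`.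

The decisive count is `∑ᵢ p_{ii}^j = k - 1`. For `x ≠ y`, the number of `z` with `ρ(z,y) =
ρ(x,z)^(2^j)` is half the sum of `P_{u^(2^j+1)} + P_{u^(2^j-1)}` over the units `u`
(`sum_formResultant_eq_pow`). For `0 < j < m` both exponents are prime to `q - 1`, and the count is
`q + 1`; for `j = 0` it is `q`. The total over `j < m` is `k - 1`.

Equal valencies together with this identity yield both conclusions: a trace computation forces every
nontrivial multiplicity to be `k`, and counting triangles gives the parameters of the product graph.
-/

open Classical in
/-- A symmetric coloring of the pairs of a finite set whose color classes form a symmetric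
association scheme with all nontrivial valencies equal to `k` and with
`∑ᵢ p_{ii}^j = k - 1` for every nontrivial color `j`. -/
structure IsPseudocyclicColoring {X C : Type*} [Fintype X] (r : X → X → C) (k : ℕ) : Prop where
  symm : ∀ x y, r x y = r y x
  diag : ∀ x y z, r x y = r z z ↔ x = y
  intersection : ∀ i j x y x' y', r x y = r x' y' →
    (Finset.univ.filter fun z => r x z = i ∧ r z y = j).card =
      (Finset.univ.filter fun z => r x' z = i ∧ r z y' = j).card
  valency : ∀ x y, x ≠ y → ∀ w, (Finset.univ.filter fun z => r w z = r x y).card = k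
  isosceles : ∀ x y, x ≠ y → (Finset.univ.filter fun z => r x z = r z y).card + 1 = k

/-- The set of color classes of a coloring of pairs. -/
def colorClasses {X C : Type*} (r : X → X → C) : Set (Set (X × X)) :=
  {R | ∃ a b, R = {p | r p.1 p.2 = r a b}}

/-! ### Eigenvalues on a primitive idempotent of an algebra of symmetric matrices. -/

section PrimitiveIdempotent

variable {X : Type*} [Fintype X] [DecidableEq X]

/-- The spectral projections of `B` are polynomials in `B`, hence lie in the commutative algebra
`A`. Each of their products with `E` is an idempotent below `E`, so it is 0 or `E`; since the
projections sum to 1, some eigenspace of `B` absorbs `E`. -/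
theorem Matrix.IsSymm.exists_smul_of_primitive {A : Subalgebra ℝ (Matrix X X ℝ)}
    (hsymm : ∀ M ∈ A, M.IsSymm) {E : Matrix X X ℝ} (hEA : E ∈ A) (hEE : E * E = E)
    (hmin : ∀ F ∈ A, F * F = F → E * F = F → F * E = F → F = 0 ∨ F = E)
    {B : Matrix X X ℝ} (hB : B ∈ A) : ∃ θ : ℝ, B * E = θ • E := by
  have hcomm : ∀ M ∈ A, ∀ N ∈ A, M * N = N * M := by
    intro M hM N hN
    have h := hsymm _ (A.mul_mem hM hN)
    rw [Matrix.IsSymm, Matrix.transpose_mul, hsymm M hM, hsymm N hN] at h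
    exact h.symm
  have hH : B.IsHermitian := by
    have := hsymm B hB
    rwa [Matrix.IsHermitian, Matrix.conjTranspose_eq_transpose_of_trivial]
  have hfin : (spectrum ℝ B).Finite := by
    rw [hH.spectrum_real_eq_range_eigenvalues]
    exact Set.finite_range _
  set s : Finset ℝ := hfin.toFinset with hs
  have hsB : ∀ x, x ∈ spectrum ℝ B ↔ x ∈ s := fun x => by simp [hs]
  have hBsa : IsSelfAdjoint B := hH
  -- A symmetric matrix is diagonalizable, so a polynomial in it depends only on its values on the
  -- spectrum.
  have key : ∀ p q : Polynomial ℝ, (∀ x ∈ s, p.eval x = q.eval x) →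
      Polynomial.aeval B p = Polynomial.aeval B q := by
    intro p q hpq
    rw [← cfc_polynomial p B, ← cfc_polynomial q B]
    exact cfc_congr fun x hx => hpq x ((hsB x).1 hx)
  have hmem : ∀ p : Polynomial ℝ, Polynomial.aeval B p ∈ A := fun p =>
    (Algebra.adjoin_le (by simpa using hB) : Algebra.adjoin ℝ {B} ≤ A)
      (Polynomial.aeval_mem_adjoin_singleton ℝ B)
  -- Lagrange basis polynomials at the eigenvalues produce the spectral projections.
  set h : ℝ → Polynomial ℝ := fun l => Lagrange.basis s id l
  have heval : ∀ l ∈ s, ∀ x ∈ s, (h l).eval x = if x = l then 1 else 0 := by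
    intro l hl x hx
    split_ifs with hxl
    · subst hxl
      exact Lagrange.eval_basis_self (v := id) (Set.injOn_id _) hx
    · exact Lagrange.eval_basis_of_ne (v := id) (i := l) (j := x) (Ne.symm hxl) hx
  have hor : ∀ l ∈ s, Polynomial.aeval B (h l) * E = 0 ∨ Polynomial.aeval B (h l) * E = E := by
    intro l hl
    have hi : Polynomial.aeval B (h l) * Polynomial.aeval B (h l) = Polynomial.aeval B (h l) := by
      rw [← map_mul]
      apply key
      intro x hx
      rw [Polynomial.eval_mul, heval l hl x hx]
      split_ifs <;> simp
    have hc := hcomm _ (hmem (h l)) _ hEA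
    apply hmin _ (A.mul_mem (hmem _) hEA)
    · rw [mul_assoc, ← mul_assoc E, ← hc, mul_assoc, hEE, ← mul_assoc, hi]
    · rw [← mul_assoc, ← hc, mul_assoc, hEE]
    · rw [mul_assoc, hEE]
  by_cases hall : ∀ l ∈ s, Polynomial.aeval B (h l) * E = 0
  · refine ⟨0, ?_⟩
    have h1 : Polynomial.aeval B (∑ l ∈ s, h l) = Polynomial.aeval B (1 : Polynomial ℝ) := by
      apply key
      intro x hx
      rw [Polynomial.eval_finsetSum, Finset.sum_congr rfl fun l hl => heval l hl x hx]
      simp [hx]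
    have h2 : E = 0 := by
      rw [← one_mul E, ← map_one (Polynomial.aeval (R := ℝ) B), ← h1, map_sum, Finset.sum_mul]
      exact Finset.sum_eq_zero hall
    simp [h2]
  · push Not at hall
    obtain ⟨l, hl, hne⟩ := hall
    have hE := (hor l hl).resolve_left hne
    refine ⟨l, ?_⟩
    have h1 : Polynomial.aeval B (Polynomial.X * h l) =
        Polynomial.aeval B (Polynomial.C l * h l) := by
      apply key
      intro x hx
      rw [Polynomial.eval_mul, Polynomial.eval_mul, heval l hl x hx]
      split_ifs with hxl <;> simp [hxl]
    rw [map_mul, map_mul, Polynomial.aeval_X, Polynomial.aeval_C] at h1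
    calc B * E = B * (Polynomial.aeval B (h l) * E) := by rw [hE]
      _ = algebraMap ℝ _ l * (Polynomial.aeval B (h l) * E) := by
        rw [← mul_assoc, h1, mul_assoc]
      _ = l • E := by rw [hE, ← Algebra.smul_def]

theorem Matrix.trace_eq_rank_of_mul_self {E : Matrix X X ℝ} (hE : E * E = E) :
    E.trace = E.rank := by
  have h : IsIdempotentElem (Matrix.toLin' E) := by
    rw [IsIdempotentElem, Module.End.mul_eq_comp, ← Matrix.toLin'_mul, hE]
  rw [← Matrix.trace_toLin'_eq, (LinearMap.IsIdempotentElem.isProj_range _ h).trace, Matrix.rank,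
    Matrix.toLin'_apply']

end PrimitiveIdempotent

namespace IsPseudocyclicColoring

variable {X C : Type*} [Fintype X] {r : X → X → C} {k : ℕ}

open Classical

/-! ### The strongly regular product graph of a pseudocyclic coloring. -/

section Counting

theorem pos (h : IsPseudocyclicColoring r k) {x y : X} (hxy : x ≠ y) : 0 < k := by
  have := h.isosceles x y hxy
  omega

theorem isAssociationScheme [Nonempty X] (h : IsPseudocyclicColoring r k) :
    IsAssociationScheme (colorClasses r) := by
  refine ⟨⟨?_, ?_⟩, ?_, ?_, ?_⟩
  · rintro ⟨a, b, hab⟩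
    have : (a, b) ∈ (∅ : Set (X × X)) := by rw [hab]; rfl
    exact this
  · rintro ⟨a, b⟩
    refine ⟨{p | r p.1 p.2 = r a b}, ⟨⟨a, b, rfl⟩, rfl⟩, ?_⟩
    rintro R ⟨⟨c, d, rfl⟩, hR⟩
    have hR' : r a b = r c d := hR
    simp [hR']
  · obtain ⟨a⟩ := ‹Nonempty X›
    refine ⟨a, a, ?_⟩
    ext ⟨x, y⟩
    simp [h.diag]
  · rintro R ⟨a, b, rfl⟩ x y hxy
    have : r x y = r a b := hxy
    exact (h.symm y x).trans this
  · rintro _ ⟨a, b, rfl⟩ _ ⟨a', b', rfl⟩ _ ⟨x, y, rfl⟩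
    refine ⟨(Finset.univ.filter fun z => r x z = r a b ∧ r z y = r a' b').card, ?_⟩
    intro x' y' hxy
    simpa using h.intersection (r a b) (r a' b') x' y' x y hxy

/-- The symmetry `p_{ij}^l = p_{il}^j` of the intersection numbers. -/
theorem intersection_swap (h : IsPseudocyclicColoring r k) (i : C) {u v s t : X}
    (huv : u ≠ v) (hst : s ≠ t) :
    (Finset.univ.filter fun z => r u z = i ∧ r z v = r s t).card =
      (Finset.univ.filter fun z => r s z = i ∧ r z t = r u v).card := by
  -- Triangles with one edge of color `i` and the others of the colors of `(u,v)` and `(s,t)` are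
  -- counted over either of the latter edges. Equal valencies make the prefactor `n k` the same in
  -- both counts.
  have hcount : ∀ {u v s t : X}, u ≠ v →
      ∑ a, ∑ b, ∑ z, (if r a b = r u v ∧ r a z = i ∧ r z b = r s t then 1 else 0) =
        Fintype.card X * (k * (Finset.univ.filter fun z => r u z = i ∧ r z v = r s t).card) := by
    intro u v s t huv
    have h1 : ∀ a b, ∑ z, (if r a b = r u v ∧ r a z = i ∧ r z b = r s t then 1 else 0) =
        if r a b = r u v then
          (Finset.univ.filter fun z => r u z = i ∧ r z v = r s t).card else 0 := by
      intro a b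
      split_ifs with hab
      · rw [← h.intersection i (r s t) a b u v hab, Finset.card_filter]
        simp [hab]
      · simp [hab]
    simp_rw [h1]
    have h2 : ∀ a, ∑ b, (if r a b = r u v then
        (Finset.univ.filter fun z => r u z = i ∧ r z v = r s t).card else 0) =
        k * (Finset.univ.filter fun z => r u z = i ∧ r z v = r s t).card := by
      intro a
      rw [← Finset.sum_filter, Finset.sum_const, h.valency u v huv a, smul_eq_mul]
    simp_rw [h2]
    simp
  have e : ∑ a, ∑ b, ∑ z, (if r a b = r u v ∧ r a z = i ∧ r z b = r s t then 1 else 0) =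
      ∑ a, ∑ b, ∑ z, (if r a b = r s t ∧ r a z = i ∧ r z b = r u v then 1 else 0) := by
    calc _ = ∑ b, ∑ a, ∑ z, (if r a b = r u v ∧ r a z = i ∧ r z b = r s t then 1 else 0) :=
          Finset.sum_comm
      _ = ∑ b, ∑ z, ∑ a, (if r a b = r u v ∧ r a z = i ∧ r z b = r s t then 1 else 0) :=
          Finset.sum_congr rfl fun b _ => Finset.sum_comm
      _ = ∑ b, ∑ z, ∑ a, (if r z b = r s t ∧ r z a = i ∧ r a b = r u v then 1 else 0) := by
          refine Finset.sum_congr rfl fun b _ => Finset.sum_congr rfl fun z _ =>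
            Finset.sum_congr rfl fun a _ => ?_
          rw [h.symm a z]
          exact if_congr (by tauto) rfl rfl
      _ = _ := Finset.sum_comm
  rw [hcount huv, hcount hst] at e
  have hn : 0 < Fintype.card X := Fintype.card_pos_iff.2 ⟨u⟩
  exact Nat.eq_of_mul_eq_mul_left (h.pos huv) (Nat.eq_of_mul_eq_mul_left hn e)

theorem productGraph_adj (h : IsPseudocyclicColoring r k) (p p' : X × X) :
    (productGraph (colorClasses r)).Adj p p' ↔ p.1 ≠ p'.1 ∧ r p.1 p'.1 = r p.2 p'.2 := by
  have hrel : ∀ p p' : X × X, (∃ R ∈ colorClasses r, R ≠ Set.diagonal X ∧ (p.1, p'.1) ∈ R ∧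
      (p.2, p'.2) ∈ R) ↔ p.1 ≠ p'.1 ∧ r p.1 p'.1 = r p.2 p'.2 := by
    intro p p'
    constructor
    · rintro ⟨_, ⟨a, b, rfl⟩, hne, h1, h2⟩
      have h1 : r p.1 p'.1 = r a b := h1
      have h2 : r p.2 p'.2 = r a b := h2
      refine ⟨fun heq => hne ?_, h1.trans h2.symm⟩
      ext ⟨x, y⟩
      have : r a b = r p.1 p.1 := by rw [← h1, ← heq]
      simp [this, h.diag]
    · rintro ⟨hne, heq⟩
      refine ⟨_, ⟨p.1, p'.1, rfl⟩, fun hd => hne ?_, rfl, heq.symm⟩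
      have : (p.1, p'.1) ∈ Set.diagonal X := by rw [← hd]; rfl
      exact this
  rw [productGraph, SimpleGraph.fromRel_adj, hrel, hrel, h.symm p'.1, h.symm p'.2]
  constructor
  · rintro ⟨-, h | h⟩
    · exact h
    · exact ⟨h.1.symm, h.2⟩
  · intro h
    exact ⟨fun e => h.1 (by rw [e]), Or.inl h⟩

/-- The number of common neighbours in the product graph. -/
theorem card_commonNeighbors (h : IsPseudocyclicColoring r k) (p p' : X × X) :
    Fintype.card ((productGraph (colorClasses r)).commonNeighbors p p') =
      ∑ w, ∑ z, if (p.1 ≠ z ∧ z ≠ p'.1) ∧ r p.1 z = r p.2 w ∧ r z p'.1 = r w p'.2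
        then 1 else 0 := by
  rw [← Fintype.sum_prod_type_right', ← Finset.card_filter, Fintype.card_subtype]
  congr 1
  ext q
  simp only [SimpleGraph.mem_commonNeighbors, h.productGraph_adj, Finset.mem_filter,
    Finset.mem_univ, true_and, h.symm p'.1, h.symm p'.2, ne_comm (a := p'.1)]
  tauto

/-- The first coordinates agree, so `w` must be the apex of an isosceles triangle over `y`, `y'`:
there are `k - 1` of these, each with `k` choices of `z`. -/
theorem sum_commonNeighbors_of_eq (h : IsPseudocyclicColoring r k) (x : X) {y y' : X}
    (hy : y ≠ y') :
    (∑ w, ∑ z, if (x ≠ z ∧ z ≠ x) ∧ r x z = r y w ∧ r z x = r w y' then 1 else 0) =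
      k * (k - 1) := by
  have h1 : ∀ w, (∑ z, if (x ≠ z ∧ z ≠ x) ∧ r x z = r y w ∧ r z x = r w y' then 1 else 0) =
      if r y w = r w y' then k else 0 := by
    intro w
    split_ifs with hw
    · have hyw : y ≠ w := by
        rintro rfl
        exact hy ((h.diag _ _ _).1 hw.symm)
      rw [← h.valency y w hyw x, Finset.card_filter]
      refine Finset.sum_congr rfl fun z _ => if_congr ⟨fun hz => hz.2.1, fun hz => ?_⟩ rfl rfl
      have hxz : x ≠ z := by
        rintro rfl
        exact hyw ((h.diag _ _ _).1 hz.symm)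
      exact ⟨⟨hxz, hxz.symm⟩, hz, by rw [h.symm, hz, hw]⟩
    · refine Finset.sum_eq_zero fun z _ => if_neg ?_
      rintro ⟨-, h2, h3⟩
      rw [h.symm z] at h3
      exact hw (h2.symm.trans h3)
  simp_rw [h1]
  rw [← Finset.sum_filter, Finset.sum_const, smul_eq_mul, ← h.isosceles y y' hy, mul_comm]
  rfl

/-- Applying `intersection_swap` for each fixed `w` moves the triangle over `(x,x')` to one over
`(w,y')`. After exchanging the sums, the inner sum counts isosceles triangles over `(y,z)`, which
the hypothesis `isosceles` evaluates. -/
theorem sum_commonNeighbors_of_ne (h : IsPseudocyclicColoring r k) {x x' y y' : X}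
    (hx : x ≠ x') (hy : y ≠ y') :
    ((∑ w, ∑ z, if (x ≠ z ∧ z ≠ x') ∧ r x z = r y w ∧ r z x' = r w y' then 1 else 0 : ℕ) : ℤ) =
      if r x x' = r y y' then (Fintype.card X + k ^ 2 - 3 * k : ℤ) else (k * (k - 1) : ℤ) := by
  have h1 : ∀ w, (∑ z, if (x ≠ z ∧ z ≠ x') ∧ r x z = r y w ∧ r z x' = r w y' then 1 else 0) =
      ∑ z, if r z y' = r x x' ∧ ((w ≠ y ∧ w ≠ y') ∧ r y w = r w z) then 1 else 0 := by
    intro w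
    by_cases hw : w ≠ y ∧ w ≠ y'
    · have := h.intersection_swap (r y w) hx hw.2
      rw [Finset.card_filter, Finset.card_filter] at this
      refine Eq.trans (Finset.sum_congr rfl fun z _ => if_congr ?_ rfl rfl)
        (this.trans (Finset.sum_congr rfl fun z _ => if_congr ?_ rfl rfl))
      · refine ⟨fun hz => hz.2, fun hz => ⟨⟨?_, ?_⟩, hz⟩⟩
        · rintro rfl
          exact hw.1 ((h.diag _ _ _).1 hz.1.symm).symm
        · rintro rfl
          exact hw.2 ((h.diag _ _ _).1 hz.2.symm)
      · rw [eq_comm (a := r w z)]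
        tauto
    · rw [Finset.sum_eq_zero, Finset.sum_eq_zero]
      · exact fun z _ => if_neg fun hz => hw hz.2.1
      · refine fun z _ => if_neg fun hz => hw ⟨?_, ?_⟩
        · rintro rfl
          exact hz.1.1 ((h.diag _ _ _).1 hz.2.1)
        · rintro rfl
          exact hz.1.2 ((h.diag _ _ _).1 hz.2.2)
  -- The isosceles count is `k - 1` for `z ≠ y` and `n` for `z = y`; the excluded apices `w = y` and
  -- `w = y'` account for the remaining corrections.
  have h2 : ∀ z, r z y' = r x x' →
      ((∑ w, if (w ≠ y ∧ w ≠ y') ∧ r y w = r w z then 1 else 0 : ℕ) : ℤ) =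
        (k - 1) + (if y = z then (Fintype.card X - k : ℤ) else 0) -
          if r x x' = r y y' then 1 else 0 := by
    intro z hz
    have h3 : ∀ w, ((if (w ≠ y ∧ w ≠ y') ∧ r y w = r w z then 1 else 0 : ℕ) : ℤ) =
        (if r y w = r w z then 1 else 0) - (if w = y then (if y = z then 1 else 0) else 0)
          - (if w = y' then (if r x x' = r y y' then 1 else 0) else 0) := by
      intro w
      by_cases hwy : w = y
      · subst hwy
        simp [hy, eq_comm (a := r w w), h.diag]
      · by_cases hwy' : w = y'
        · subst hwy'
          simp [hwy, h.symm w z, hz, eq_comm]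
        · simp [hwy, hwy']
    rw [Nat.cast_sum, Finset.sum_congr rfl fun w _ => h3 w, Finset.sum_sub_distrib,
      Finset.sum_sub_distrib, Finset.sum_ite_eq' , Finset.sum_ite_eq']
    simp only [Finset.mem_univ, if_true]
    rw [Finset.sum_boole]
    by_cases hyz : y = z
    · subst hyz
      have : (Finset.univ.filter fun w => r y w = r w y) = Finset.univ := by
        ext w; simp [h.symm]
      rw [this, Finset.card_univ]
      simp
    · rw [← h.isosceles y z hyz]
      simp [hyz]
  rw [Finset.sum_congr rfl fun w _ => h1 w, Finset.sum_comm, Nat.cast_sum]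
  have h4 : ∀ z, ((∑ w, if r z y' = r x x' ∧ ((w ≠ y ∧ w ≠ y') ∧ r y w = r w z)
      then 1 else 0 : ℕ) : ℤ) = if r z y' = r x x' then
        ((k - 1) - (if r x x' = r y y' then 1 else 0) : ℤ) +
          (if y = z then (Fintype.card X - k : ℤ) else 0) else 0 := by
    intro z
    by_cases hz : r z y' = r x x'
    · have := h2 z hz
      rw [if_pos hz]
      simp only [hz, true_and]
      rw [this]
      ring
    · simp [hz]
  rw [Finset.sum_congr rfl fun z _ => h4 z, ← Finset.sum_filter, Finset.sum_add_distrib,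
    Finset.sum_const, Finset.sum_ite_eq]
  have h5 : (Finset.univ.filter fun z => r z y' = r x x').card = k := by
    simp_rw [h.symm _ y']
    exact h.valency x x' hx y'
  rw [h5]
  simp only [Finset.mem_filter, Finset.mem_univ, true_and, nsmul_eq_mul, eq_comm (a := r y y')]
  split_ifs <;> ring

/-- The product graph of a pseudocyclic scheme is a strongly regular graph of Latin square type. -/
theorem isLatinSquareTypeSRG (h : IsPseudocyclicColoring r k) [Nontrivial X] {l : ℕ}
    (hl : (l : ℤ) = Fintype.card X + (k : ℤ) ^ 2 - 3 * k) :
    IsLatinSquareTypeSRG (productGraph (colorClasses r)) (Fintype.card X ^ 2)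
      (k * (Fintype.card X - 1)) l (k * (k - 1)) := by
  obtain ⟨a, b, hab⟩ := exists_pair_ne X
  have hk := h.pos hab
  have hn : 0 < Fintype.card X := Fintype.card_pos_iff.2 ⟨a⟩
  refine ⟨⟨?_, ?_, ?_, ?_⟩, Fintype.card X, k, hk, ?_, ?_, ?_, hl, ?_⟩
  · rw [Fintype.card_prod, sq]
  · intro p
    rw [SimpleGraph.degree, SimpleGraph.neighborFinset_eq_filter]
    simp_rw [h.productGraph_adj]
    rw [Finset.card_filter, Fintype.sum_prod_type]
    have h1 : ∀ z, (∑ w, if p.1 ≠ z ∧ r p.1 z = r p.2 w then 1 else 0) =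
        if p.1 ≠ z then k else 0 := by
      intro z
      split_ifs with hz
      · rw [← h.valency p.1 z hz p.2, Finset.card_filter]
        simp [hz, eq_comm]
      · simp [hz]
    simp_rw [h1]
    rw [← Finset.sum_filter, Finset.sum_const, Finset.filter_ne, Finset.card_erase_of_mem
      (Finset.mem_univ _), Finset.card_univ, smul_eq_mul, mul_comm]
  · intro p p' hadj
    rw [h.productGraph_adj] at hadj
    have hne : p.2 ≠ p'.2 := by
      intro e
      have := hadj.2
      rw [e] at this
      exact hadj.1 ((h.diag _ _ _).1 this)
    zify
    rw [h.card_commonNeighbors, h.sum_commonNeighbors_of_ne hadj.1 hne, if_pos hadj.2, hl]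
  · intro p p' hne hadj
    rw [h.productGraph_adj, not_and] at hadj
    rw [h.card_commonNeighbors]
    by_cases h1 : p.1 = p'.1
    · have h2 : p.2 ≠ p'.2 := fun h2 => hne (Prod.ext h1 h2)
      rw [← h1]
      exact h.sum_commonNeighbors_of_eq _ h2
    · by_cases h2 : p.2 = p'.2
      · rw [← h.sum_commonNeighbors_of_eq p.2 h1, Finset.sum_comm, ← h2]
        refine Finset.sum_congr rfl fun z _ => Finset.sum_congr rfl fun w _ =>
          if_congr ?_ rfl rfl
        constructor
        · rintro ⟨⟨h3, h4⟩, h5, h6⟩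
          have : p.2 ≠ w := by
            rintro rfl
            exact h3 ((h.diag _ _ _).1 h5)
          exact ⟨⟨this, this.symm⟩, h5.symm, h6.symm⟩
        · rintro ⟨⟨h3, h4⟩, h5, h6⟩
          refine ⟨⟨?_, ?_⟩, h5.symm, h6.symm⟩
          · rintro rfl
            exact h3 ((h.diag _ _ _).1 h5)
          · rintro rfl
            exact h4 ((h.diag _ _ _).1 h6)
      · have h3 := h.sum_commonNeighbors_of_ne h1 h2
        rw [if_neg (hadj h1)] at h3
        apply Nat.cast_injective (R := ℤ)
        rw [h3, Nat.cast_mul, Nat.cast_sub (show 1 ≤ k from hk), Nat.cast_one]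
  · rw [← h.valency a b hab a]
    exact (Finset.card_le_univ _).trans (Nat.le_succ _)
  · push_cast; rfl
  · push_cast [Nat.cast_sub (show 1 ≤ Fintype.card X from hn)]; rfl
  · push_cast [Nat.cast_sub (show 1 ≤ k from hk)]; ring

end Counting

/-! ### All nontrivial multiplicities of a pseudocyclic coloring equal the valency. -/

section Multiplicities

/-- Equality of all intersection numbers says that the multisets of color pairs seen from `z`
coincide; no finiteness of `C` is needed. -/
theorem sum_eq_sum_of_eq (h : IsPseudocyclicColoring r k) {x y x' y' : X}
    (hxy : r x y = r x' y') (g : C → C → ℝ) :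
    ∑ z, g (r x z) (r z y) = ∑ z, g (r x' z) (r z y') := by
  have hm : Finset.univ.val.map (fun z => (r x z, r z y)) =
      Finset.univ.val.map (fun z => (r x' z, r z y')) := by
    ext ⟨i, j⟩
    rw [Multiset.count_map, Multiset.count_map]
    have := h.intersection i j x y x' y' hxy
    simp only [Finset.card_def, Finset.filter_val] at this
    simp only [Prod.mk.injEq, eq_comm (a := i), eq_comm (a := j)]
    exact this
  have := congrArg (fun s => (s.map fun c : C × C => g c.1 c.2).sum) hm
  rw [Multiset.map_map, Multiset.map_map] at this
  exact this

theorem exists_eq_comp {X C : Type*} {r : X → X → C} {N : Matrix X X ℝ}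
    (hN : ∀ x y x' y', r x y = r x' y' → N x y = N x' y') :
    ∃ g : C → ℝ, ∀ x y, N x y = g (r x y) := by
  have h : Function.FactorsThrough (fun p : X × X => N p.1 p.2) (fun p => r p.1 p.2) :=
    fun p p' hp => hN _ _ _ _ hp
  obtain ⟨g, hg⟩ := (Function.factorsThrough_iff _).1 h
  exact ⟨g, fun x y => congrFun hg (x, y)⟩

/-- Elements of the Bose-Mesner algebra are constant on the relations of the scheme. -/
theorem exists_eq_comp_of_mem_boseMesner (h : IsPseudocyclicColoring r k) {M : Matrix X X ℝ}
    (hM : M ∈ boseMesner (colorClasses r)) : ∃ g : C → ℝ, ∀ x y, M x y = g (r x y) := by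
  rw [boseMesner] at hM
  induction hM using Algebra.adjoin_induction with
  | mem M hM =>
    obtain ⟨R, ⟨a, b, rfl⟩, rfl⟩ := hM
    exact ⟨fun c => if c = r a b then 1 else 0, fun x y => by simp [relMatrix]⟩
  | algebraMap c =>
    apply exists_eq_comp
    intro x y x' y' hxy
    have : x = y ↔ x' = y' := by rw [← h.diag x y x, hxy, h.diag]
    simp [Matrix.algebraMap_matrix_apply, this]
  | add M N _ _ hM hN =>
    obtain ⟨g, hg⟩ := hM
    obtain ⟨g', hg'⟩ := hN
    exact ⟨fun c => g c + g' c, fun x y => by simp [hg, hg']⟩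
  | mul M N _ _ hM hN =>
    obtain ⟨g, hg⟩ := hM
    obtain ⟨g', hg'⟩ := hN
    apply exists_eq_comp
    intro x y x' y' hxy
    simp only [Matrix.mul_apply, hg, hg']
    exact h.sum_eq_sum_of_eq hxy fun c c' => g c * g' c'

theorem apply_eq_of_mem_boseMesner (h : IsPseudocyclicColoring r k) {M : Matrix X X ℝ}
    (hM : M ∈ boseMesner (colorClasses r)) {x y x' y' : X} (hxy : r x y = r x' y') :
    M x y = M x' y' := by
  obtain ⟨g, hg⟩ := h.exists_eq_comp_of_mem_boseMesner hM
  rw [hg, hg, hxy]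

theorem isSymm_of_mem_boseMesner (h : IsPseudocyclicColoring r k) {M : Matrix X X ℝ}
    (hM : M ∈ boseMesner (colorClasses r)) : M.IsSymm := by
  ext x y
  exact h.apply_eq_of_mem_boseMesner hM (h.symm y x)

/-- The adjacency matrix of a color. -/
noncomputable def colorMatrix (r : X → X → C) (c : C) : Matrix X X ℝ :=
  Matrix.of fun x y => if r x y = c then 1 else 0

theorem colorMatrix_mem (r : X → X → C) (x y : X) :
    colorMatrix r (r x y) ∈ boseMesner (colorClasses r) := by
  refine Algebra.subset_adjoin ⟨{p | r p.1 p.2 = r x y}, ⟨x, y, rfl⟩, ?_⟩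
  ext a b
  simp [relMatrix, colorMatrix]

/-- The finite set of colors that occur. -/
noncomputable def colors (r : X → X → C) : Finset C :=
  Finset.univ.image fun p : X × X => r p.1 p.2

theorem mem_colors (r : X → X → C) (x y : X) : r x y ∈ colors r :=
  Finset.mem_image.2 ⟨(x, y), Finset.mem_univ _, rfl⟩

theorem sum_colorMatrix_eq (r : X → X → C) :
    ∑ c ∈ colors r, colorMatrix r c = Matrix.of fun _ _ => 1 := by
  ext x y
  simp [Matrix.sum_apply, colorMatrix, mem_colors]

/-- The `(x,y)` entry counts the `z` with `r x z = r z y`: all `n` points on the diagonal, `k - 1`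
off it. -/
theorem sum_colorMatrix_sq (h : IsPseudocyclicColoring r k) :
    ∑ c ∈ colors r, colorMatrix r c * colorMatrix r c =
      (Fintype.card X - k + 1 : ℝ) • (1 : Matrix X X ℝ) +
        (k - 1 : ℝ) • Matrix.of fun _ _ => (1 : ℝ) := by
  ext x y
  have h1 : (∑ c ∈ colors r, colorMatrix r c * colorMatrix r c) x y =
      ((Finset.univ.filter fun z => r x z = r z y).card : ℝ) := by
    simp only [Matrix.sum_apply, Matrix.mul_apply, colorMatrix, Matrix.of_apply]
    rw [Finset.sum_comm, ← Finset.sum_boole]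
    refine Finset.sum_congr rfl fun z _ => ?_
    simp [mem_colors, eq_comm]
  rw [h1]
  by_cases hxy : x = y
  · subst hxy
    have : (Finset.univ.filter fun z => r x z = r z x) = Finset.univ := by
      ext z; simp [h.symm x z]
    rw [this]
    simp
  · rw [← h.isosceles x y hxy]
    simp [hxy]

/-- With `A_c E = θ_c E` and `t = tr E`, the sum of `θ E` over all pairs is evaluated twice: through
`∑ θ_c² = n - k + 1`, and through `θ_c t = n k E_c` for nondiagonal `c`. Comparison leaves `n t (t -
k) = 0`. -/
theorem rank_of_isPrimitiveIdempotentOf (h : IsPseudocyclicColoring r k) [Nontrivial X]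
    {E : Matrix X X ℝ} (hE : IsPrimitiveIdempotentOf (colorClasses r) E)
    (hne : E ≠ (Fintype.card X : ℝ)⁻¹ • Matrix.of (fun _ _ => (1 : ℝ))) : E.rank = k := by
  obtain ⟨hEA, hEE, hE0, hmin⟩ := hE
  obtain ⟨a, b, hab⟩ := exists_pair_ne X
  have hn : (0 : ℝ) < Fintype.card X := by
    exact_mod_cast Fintype.card_pos_iff.2 ⟨a⟩
  have hk : (0 : ℝ) < k := by exact_mod_cast h.pos hab
  have hsymm : E.IsSymm := h.isSymm_of_mem_boseMesner hEA
  have hEs : ∀ x y, E x y = E y x := fun x y => (hsymm.apply x y).symm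
  have hscal : ∀ c ∈ colors r, ∃ θ : ℝ, colorMatrix r c * E = θ • E := by
    intro c hc
    obtain ⟨p, -, rfl⟩ := Finset.mem_image.1 hc
    exact Matrix.IsSymm.exists_smul_of_primitive (fun M hM => h.isSymm_of_mem_boseMesner hM)
      hEA hEE hmin (colorMatrix_mem r _ _)
  choose! θ hθ using hscal
  set J : Matrix X X ℝ := Matrix.of fun _ _ => (1 : ℝ) with hJ
  -- `J E` is a constant matrix and also a multiple of `E`; if it were nonzero, `E` would be a
  -- multiple of `J`, hence the excluded idempotent.
  have hJE : J * E = 0 := by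
    have h1 : J * E = (∑ c ∈ colors r, θ c) • E := by
      rw [hJ, ← sum_colorMatrix_eq r, Finset.sum_mul, Finset.sum_smul]
      exact Finset.sum_congr rfl hθ
    have h2 : ∀ x y, (J * E) x y = ∑ z, E z a := by
      intro x y
      simp only [hJ, Matrix.mul_apply, Matrix.of_apply, one_mul]
      obtain ⟨g, hg⟩ := h.exists_eq_comp_of_mem_boseMesner hEA
      have := h.sum_eq_sum_of_eq (x := y) (y := y) (x' := a) (y' := a)
        (((h.diag y y a).2 rfl)) fun _ c => g c
      simpa [hg] using this
    by_contra hJE0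
    have hs : (∑ c ∈ colors r, θ c) ≠ 0 := by
      intro hs
      rw [hs, zero_smul] at h1
      exact hJE0 h1
    obtain ⟨e, he⟩ : ∃ e : ℝ, E = e • J := by
      refine ⟨(∑ c ∈ colors r, θ c)⁻¹ * ∑ z, E z a, ?_⟩
      ext x y
      have := congrFun (congrFun h1 x) y
      rw [h2, Matrix.smul_apply, smul_eq_mul] at this
      rw [Matrix.smul_apply, this, hJ, Matrix.of_apply]
      field_simp
      simp
    have he0 : e ≠ 0 := by
      rintro rfl
      exact hE0 (by rw [he, zero_smul])
    have h3 := congrFun (congrFun hEE a) a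
    rw [he, Matrix.mul_apply] at h3
    simp only [hJ, Matrix.smul_apply, Matrix.of_apply, smul_eq_mul, mul_one, Finset.sum_const,
      Finset.card_univ, nsmul_eq_mul] at h3
    apply hne
    rw [he]
    congr 1
    have h4 : (Fintype.card X : ℝ) * e = 1 := by
      apply mul_right_cancel₀ he0
      linarith
    exact eq_inv_of_mul_eq_one_right h4
  set t : ℝ := E.trace with ht
  have ht0 : 0 < t := by
    have h1 : t = E.rank := Matrix.trace_eq_rank_of_mul_self hEE
    have h2 : E.rank ≠ 0 := by
      intro h2
      rw [Matrix.rank, Submodule.finrank_eq_zero, LinearMap.range_eq_bot, ← Matrix.toLin'_apply',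
        map_eq_zero_iff _ (Matrix.toLin').injective] at h2
      exact hE0 h2
    rw [h1]
    exact_mod_cast Nat.pos_of_ne_zero h2
  have hθsq : ∑ c ∈ colors r, θ c ^ 2 = Fintype.card X - k + 1 := by
    have h1 : (∑ c ∈ colors r, colorMatrix r c * colorMatrix r c) * E =
        (∑ c ∈ colors r, θ c ^ 2) • E := by
      rw [Finset.sum_mul, Finset.sum_smul]
      refine Finset.sum_congr rfl fun c hc => ?_
      rw [mul_assoc, hθ c hc, Matrix.mul_smul, hθ c hc, smul_smul, sq]
    rw [h.sum_colorMatrix_sq, add_mul, Matrix.smul_mul, Matrix.smul_mul, hJE, smul_zero, add_zero,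
      one_mul] at h1
    exact (smul_left_injective ℝ hE0 h1).symm
  have htr : ∀ x y, θ (r x y) * t = ∑ u, ∑ v, if r u v = r x y then E x y else 0 := by
    intro x y
    have h1 := congrArg Matrix.trace (hθ _ (mem_colors r x y))
    rw [Matrix.trace_smul, smul_eq_mul] at h1
    rw [← h1, Matrix.trace]
    simp only [Matrix.diag_apply, Matrix.mul_apply, colorMatrix, Matrix.of_apply, ite_mul,
      one_mul, zero_mul]
    refine Finset.sum_congr rfl fun u _ => Finset.sum_congr rfl fun v _ => ?_
    split_ifs with huv
    · rw [hEs v u]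
      exact h.apply_eq_of_mem_boseMesner hEA huv
    · rfl
  have hdiag : ∀ x, E x x = t / Fintype.card X := by
    intro x
    have h1 : ∀ y, E y y = E x x := fun y =>
      h.apply_eq_of_mem_boseMesner hEA ((h.diag y y x).2 rfl)
    rw [ht, Matrix.trace]
    simp [h1]
  have hθ0 : ∀ x, θ (r x x) = 1 := by
    intro x
    apply mul_right_cancel₀ ht0.ne'
    rw [htr]
    simp only [h.diag, Finset.sum_ite_eq, Finset.mem_univ, if_true, Finset.sum_const,
      Finset.card_univ, nsmul_eq_mul, hdiag]
    field_simp
  have hθ1 : ∀ x y, x ≠ y → θ (r x y) * t = Fintype.card X * k * E x y := by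
    intro x y hxy
    rw [htr]
    have : ∀ u, (∑ v, if r u v = r x y then E x y else 0) = k * E x y := by
      intro u
      rw [← Finset.sum_filter, Finset.sum_const, h.valency x y hxy u, nsmul_eq_mul]
    simp [this, mul_assoc]
  have hS : ∑ x, ∑ y, E x y ^ 2 = t := by
    rw [ht]
    conv_rhs => rw [← hEE]
    rw [Matrix.trace]
    simp only [Matrix.diag_apply, Matrix.mul_apply]
    refine Finset.sum_congr rfl fun x _ => Finset.sum_congr rfl fun y _ => ?_
    rw [hEs y x, sq]
  have hS2 : ∑ x, ∑ y, θ (r x y) * E x y = (Fintype.card X - k + 1) * t := by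
    have h1 : ∑ x, ∑ y, θ (r x y) * E x y =
        Matrix.trace (∑ c ∈ colors r, θ c • (colorMatrix r c * E)) := by
      simp only [Matrix.trace, Matrix.diag_apply, Matrix.sum_apply, Matrix.smul_apply,
        Matrix.mul_apply, colorMatrix, Matrix.of_apply, ite_mul, one_mul, zero_mul, smul_eq_mul]
      refine Finset.sum_congr rfl fun x _ => ?_
      simp_rw [Finset.mul_sum]
      rw [Finset.sum_comm]
      refine Finset.sum_congr rfl fun y _ => ?_
      simp [mem_colors, hEs y x]
    rw [h1, ← hθsq, Finset.sum_congr rfl fun c hc => by rw [hθ c hc, smul_smul, ← sq],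
      ← Finset.sum_smul, Matrix.trace_smul, smul_eq_mul]
  -- The diagonal color has valency 1 instead of `k`, whence the extra term.
  have hS3 : ∀ x y, t * (θ (r x y) * E x y) = Fintype.card X * k * E x y ^ 2 +
      if x = y then t ^ 2 / Fintype.card X - k * t ^ 2 / Fintype.card X else 0 := by
    intro x y
    split_ifs with hxy
    · subst hxy
      rw [hθ0, hdiag]
      field_simp
      ring
    · linear_combination E x y * hθ1 x y hxy
  have hfin : t * ((Fintype.card X - k + 1) * t) =
      Fintype.card X * k * t + (t ^ 2 - k * t ^ 2) := by
    rw [← hS2, Finset.mul_sum]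
    simp_rw [Finset.mul_sum, hS3, Finset.sum_add_distrib, ← Finset.mul_sum, hS]
    simp
    field_simp
  have h5 : t = k := by
    have : (Fintype.card X * t) * (t - k) = 0 := by linear_combination hfin
    have h6 := (mul_eq_zero.1 this).resolve_left (by positivity)
    linarith
  have h7 : (E.rank : ℝ) = k := by rw [← Matrix.trace_eq_rank_of_mul_self hEE, ← ht, h5]
  exact_mod_cast h7

theorem isPseudocyclic (h : IsPseudocyclicColoring r k) [Nontrivial X] :
    IsPseudocyclic (colorClasses r) :=
  ⟨h.isAssociationScheme, k, fun _ hE hne => h.rank_of_isPrimitiveIdempotentOf hE hne⟩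

end Multiplicities

end IsPseudocyclicColoring

/-! ### Trace, additive characters and binary quadratic forms in characteristic two. -/

section BinaryField

variable {F : Type*} [Field F] [Fintype F] [Algebra (ZMod 2) F]

open Classical

theorem charTwo_of_algebra (F : Type*) [Field F] [Algebra (ZMod 2) F] : CharP F 2 :=
  charP_of_injective_algebraMap (algebraMap (ZMod 2) F).injective 2

theorem two_eq_zero_of_algebra (F : Type*) [Field F] [Algebra (ZMod 2) F] : (2 : F) = 0 := by
  have := charTwo_of_algebra F
  exact_mod_cast CharP.cast_eq_zero F 2

theorem zmodTwo_eq_zero_or_one (a : ZMod 2) : a = 0 ∨ a = 1 := by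
  revert a
  decide

theorem trace_sq (t : F) : Algebra.trace (ZMod 2) F (t ^ 2) = Algebra.trace (ZMod 2) F t := by
  have h := Algebra.trace_eq_of_algEquiv (FiniteField.frobeniusAlgEquivOfAlgebraic (ZMod 2) F) t
  simpa using h

theorem trace_pow_two_pow (t : F) (j : ℕ) :
    Algebra.trace (ZMod 2) F (t ^ 2 ^ j) = Algebra.trace (ZMod 2) F t := by
  induction j with
  | zero => simp
  | succ j ih => rw [pow_succ, pow_mul, trace_sq, ih]

/-- The additive form of Hilbert's Theorem 90 for finite fields of characteristic two. -/
theorem trace_eq_zero_iff (t : F) :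
    Algebra.trace (ZMod 2) F t = 0 ↔ ∃ u : F, u ^ 2 + u = t := by
  have h2 := two_eq_zero_of_algebra F
  let L : F →ₗ[ZMod 2] F := (FiniteField.frobeniusAlgHom (ZMod 2) F).toLinearMap + LinearMap.id
  have hL : ∀ u, L u = u ^ 2 + u := fun u => by simp [L]
  have hker : LinearMap.ker L = Submodule.span (ZMod 2) {1} := by
    ext u
    rw [LinearMap.mem_ker, hL, Submodule.mem_span_singleton]
    constructor
    · intro hu
      have : u * (u + 1) = 0 := by linear_combination hu
      rcases mul_eq_zero.1 this with h | h
      · exact ⟨0, by simp [h]⟩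
      · exact ⟨1, by rw [one_smul]; linear_combination h2 - h⟩
    · rintro ⟨a, rfl⟩
      rcases zmodTwo_eq_zero_or_one a with rfl | rfl
      · simp
      · rw [one_smul]; linear_combination h2
  -- The kernel of `u ↦ u² + u` is the prime field, so its image has codimension 1, like the kernel
  -- of the trace; one inclusion suffices.
  have hle : LinearMap.range L ≤ LinearMap.ker (Algebra.trace (ZMod 2) F) := by
    rintro _ ⟨u, rfl⟩
    rw [LinearMap.mem_ker, hL, map_add, trace_sq]
    exact CharTwo.add_self_eq_zero _
  have h1 := LinearMap.finrank_range_add_finrank_ker L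
  rw [hker, finrank_span_singleton one_ne_zero] at h1
  have h3 := LinearMap.finrank_range_add_finrank_ker (Algebra.trace (ZMod 2) F)
  rw [LinearMap.range_eq_top.2 (Algebra.trace_surjective (ZMod 2) F), finrank_top,
    Module.finrank_self] at h3
  have heq := Submodule.eq_of_le_of_finrank_eq hle (by omega)
  rw [← LinearMap.mem_ker, ← heq, LinearMap.mem_range]
  simp_rw [hL]

/-- The sign `(-1) ^ Tr(t)`. -/
noncomputable def traceSign (t : F) : ℝ := if Algebra.trace (ZMod 2) F t = 0 then 1 else -1

theorem traceSign_zero : traceSign (0 : F) = 1 := by simp [traceSign]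

theorem traceSign_of_trace_eq_zero {t : F} (h : Algebra.trace (ZMod 2) F t = 0) :
    traceSign t = 1 := if_pos h

theorem traceSign_of_trace_eq_one {t : F} (h : Algebra.trace (ZMod 2) F t = 1) :
    traceSign t = -1 := by
  simp [traceSign, h]

theorem traceSign_add (s t : F) : traceSign (s + t) = traceSign s * traceSign t := by
  simp only [traceSign, map_add]
  rcases zmodTwo_eq_zero_or_one (Algebra.trace (ZMod 2) F s) with h | h <;>
  rcases zmodTwo_eq_zero_or_one (Algebra.trace (ZMod 2) F t) with h' | h' <;>
  simp [h, h', CharTwo.add_self_eq_zero]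

theorem traceSign_sq_add (u : F) : traceSign (u ^ 2 + u) = 1 :=
  if_pos ((trace_eq_zero_iff _).2 ⟨u, rfl⟩)

theorem traceSign_pow_two_pow (t : F) (j : ℕ) : traceSign (t ^ 2 ^ j) = traceSign t := by
  rw [traceSign, trace_pow_two_pow, traceSign]

theorem sum_traceSign_mul (b : F) :
    ∑ e : F, traceSign (e * b) = if b = 0 then (Fintype.card F : ℝ) else 0 := by
  split_ifs with hb
  · simp [hb, traceSign_zero]
  · obtain ⟨t, ht⟩ := Algebra.trace_surjective (ZMod 2) F 1
    -- Translation by `t / b` with `Tr(t) = 1` changes the sign of the sum, which therefore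
    -- vanishes.
    have h1 : ∑ e : F, traceSign ((e + t / b) * b) = ∑ e : F, traceSign (e * b) :=
      Equiv.sum_comp (Equiv.addRight (t / b)) fun e => traceSign (e * b)
    simp_rw [add_mul, div_mul_cancel₀ t hb, traceSign_add, traceSign_of_trace_eq_one ht] at h1
    rw [← Finset.sum_mul] at h1
    linarith

theorem sum_traceSign_mul_add (s t : F) :
    ∑ e : F, traceSign (e * (s + t)) = if s = t then (Fintype.card F : ℝ) else 0 := by
  have := charTwo_of_algebra F
  rw [sum_traceSign_mul]
  exact if_congr CharTwo.add_eq_zero rfl rfl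

theorem bijective_pow_two_pow (j : ℕ) : Function.Bijective fun t : F => t ^ 2 ^ j := by
  have := charTwo_of_algebra F
  have : ExpChar F 2 := ExpChar.prime Nat.prime_two
  exact Finite.injective_iff_bijective.1 (iterateFrobenius_inj F 2 j)

theorem bijective_sq : Function.Bijective fun t : F => t ^ 2 := by
  simpa using bijective_pow_two_pow (F := F) 1

theorem sum_sq_add_self (t : F) :
    ∑ u : F, (if u ^ 2 + u = t then (1 : ℝ) else 0) = 1 + traceSign t := by
  have h2 := two_eq_zero_of_algebra F
  by_cases ht : Algebra.trace (ZMod 2) F t = 0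
  · obtain ⟨u, rfl⟩ := (trace_eq_zero_iff t).1 ht
    rw [traceSign_sq_add, Finset.sum_boole]
    have : (Finset.univ.filter fun w : F => w ^ 2 + w = u ^ 2 + u) = {u, u + 1} := by
      ext w
      simp only [Finset.mem_filter, Finset.mem_univ, true_and, Finset.mem_insert,
        Finset.mem_singleton]
      constructor
      · intro h
        have : (w - u) * (w - (u + 1)) = 0 := by
          linear_combination h + (u ^ 2 + u - w * u - w) * h2
        rcases mul_eq_zero.1 this with h | h
        · exact Or.inl (sub_eq_zero.1 h)
        · exact Or.inr (sub_eq_zero.1 h)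
      · rintro (rfl | rfl)
        · rfl
        · linear_combination (u + 1) * h2
    rw [this, Finset.card_pair (by simp)]
    norm_num
  · rw [Finset.sum_eq_zero]
    · simp [traceSign, ht]
    · exact fun u _ => if_neg fun hu => ht ((trace_eq_zero_iff t).2 ⟨u, hu⟩)

/-- Representatives of the points of the projective line. -/
def projVec : Option F → F × F
  | none => (1, 0)
  | some s => (s, 1)

theorem projVec_ne_zero (v : Option F) : projVec v ≠ 0 := by
  cases v <;> simp [projVec]

/-- The determinant of two vectors (in characteristic two). -/
def det₂ (v w : F × F) : F := v.1 * w.2 + v.2 * w.1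

theorem det₂_projVec_eq_zero (v w : Option F) : det₂ (projVec v) (projVec w) = 0 ↔ v = w := by
  have := charTwo_of_algebra F
  cases v <;> cases w <;> simp [projVec, det₂, CharTwo.add_eq_zero]

theorem exists_det₂_ne_zero {v : F × F} (hv : v ≠ 0) : ∃ w, det₂ v w ≠ 0 := by
  by_cases h : v.1 = 0
  · refine ⟨(1, 0), ?_⟩
    have : v.2 ≠ 0 := fun h' => hv (Prod.ext h h')
    simpa [det₂]
  · exact ⟨(0, 1), by simpa [det₂]⟩

/-- The number of zeros on the projective line of a nonalternating binary quadratic form. -/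
theorem sum_projVec_form (α γ : F) {β : F} (hβ : β ≠ 0) :
    ∑ v : Option F, (if α * (projVec v).1 ^ 2 + β * ((projVec v).1 * (projVec v).2) +
      γ * (projVec v).2 ^ 2 = 0 then (1 : ℝ) else 0) = 1 + traceSign (α * γ / β ^ 2) := by
  have := charTwo_of_algebra F
  rw [Fintype.sum_option]
  by_cases hα : α = 0
  · subst hα
    have : ∀ s : F, β * s + γ = 0 ↔ s = γ / β := by
      intro s
      rw [CharTwo.add_eq_zero, eq_div_iff hβ, mul_comm]
    simp [projVec, this, traceSign_zero]
  · rw [← sum_sq_add_self, ← Equiv.sum_comp (Equiv.mulLeft₀ (β / α) (div_ne_zero hβ hα))]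
    have : ∀ u : F, α * (β / α * u) ^ 2 + β * (β / α * u) + γ = 0 ↔
        u ^ 2 + u = α * γ / β ^ 2 := by
      intro u
      rw [CharTwo.add_eq_zero, eq_div_iff (pow_ne_zero 2 hβ)]
      constructor
      · intro h
        rw [← h]
        field_simp
      · intro h
        apply mul_left_cancel₀ hα
        rw [← h]
        field_simp
    simp [projVec, hα, this]

/-- The number of points of the projective line where two proportional square forms vanish. -/
theorem sum_projVec_sq_form {α γ : F} (h : ¬ (α = 0 ∧ γ = 0)) :
    ∑ v : Option F, (if α * (projVec v).1 ^ 2 + γ * (projVec v).2 ^ 2 = 0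
      then (1 : ℝ) else 0) = 1 := by
  have := charTwo_of_algebra F
  rw [Fintype.sum_option]
  by_cases hα : α = 0
  · have : γ ≠ 0 := fun h' => h ⟨hα, h'⟩
    simp [projVec, hα, this]
  · obtain ⟨s₀, hs₀⟩ := (bijective_sq (F := F)).2 (γ / α)
    have : ∀ s : F, α * s ^ 2 + γ = 0 ↔ s = s₀ := by
      intro s
      rw [CharTwo.add_eq_zero, mul_comm, ← eq_div_iff hα, ← hs₀]
      exact (bijective_sq (F := F)).1.eq_iff
    simp [projVec, hα, this]

end BinaryField

/-! ### Anisotropic forms, their resultants and the algebra of proportionality counts. -/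

section EllipticPoints

variable {F : Type*} [Field F] [Fintype F] [Algebra (ZMod 2) F]

open Classical

variable (F) in
/-- The coordinates `(x, y)` of the exterior lines: the pairs with `Tr(x y) = 1`. -/
abbrev EllipticPoint : Type _ := {p : F × F // Algebra.trace (ZMod 2) F (p.1 * p.2) = 1}

/-- The quadratic form `x s² + s t + y t²`. -/
def ellipticForm (x v : F × F) : F := x.1 * v.1 ^ 2 + v.1 * v.2 + x.2 * v.2 ^ 2

/-- The resultant of two forms `x s² + s t + y t²` and `z s² + s t + u t²`. -/
def formResultant (x y : F × F) : F :=
  x.1 ^ 2 * y.2 ^ 2 + x.2 ^ 2 * y.1 ^ 2 + (x.1 + y.1) * (x.2 + y.2)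

theorem ellipticForm_mul (z v w : F × F) : ellipticForm z v * ellipticForm z w =
    z.1 * z.2 * det₂ v w ^ 2 + (z.1 * v.1 * w.1 + v.1 * w.2 + z.2 * v.2 * w.2) ^ 2 +
      (z.1 * v.1 * w.1 + v.1 * w.2 + z.2 * v.2 * w.2) * det₂ v w := by
  have h2 := two_eq_zero_of_algebra F
  simp only [ellipticForm, det₂]
  linear_combination (-(2 * z.1 * z.2 * v.1 * v.2 * w.1 * w.2 + z.1 * v.1 ^ 2 * w.1 * w.2 +
    z.2 * v.1 * v.2 * w.2 ^ 2 + v.1 ^ 2 * w.2 ^ 2)) * h2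

/-- Modulo elements `g² + g`, which have trace 0, the quotient is the constant `z₁ z₂`. This gives
both the anisotropy of elliptic forms and the only constraint on a pair of their values. -/
theorem trace_ellipticForm_mul (z v w : F × F) (h : det₂ v w ≠ 0) :
    Algebra.trace (ZMod 2) F (ellipticForm z v * ellipticForm z w / det₂ v w ^ 2) =
      Algebra.trace (ZMod 2) F (z.1 * z.2) := by
  set g := (z.1 * v.1 * w.1 + v.1 * w.2 + z.2 * v.2 * w.2) / det₂ v w with hg
  have h1 : ellipticForm z v * ellipticForm z w / det₂ v w ^ 2 =
      z.1 * z.2 + (g ^ 2 + g) := by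
    rw [ellipticForm_mul, hg]
    field_simp
    ring
  rw [h1, map_add, (trace_eq_zero_iff (g ^ 2 + g)).2 ⟨g, rfl⟩, add_zero]

theorem ellipticForm_ne_zero (z : EllipticPoint F) {v : F × F} (hv : v ≠ 0) :
    ellipticForm z.1 v ≠ 0 := by
  intro h
  obtain ⟨w, hw⟩ := exists_det₂_ne_zero hv
  have := trace_ellipticForm_mul z.1 v w hw
  rw [h, z.2, zero_mul, zero_div, map_zero] at this
  exact zero_ne_one this

/-- Two values at independent vectors determine the form by linear algebra; the resulting form is
elliptic if and only if `a b / det²` has trace 1. -/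
theorem sum_ellipticForm_eq_eq (a b : F) {v w : F × F} (h : det₂ v w ≠ 0) :
    ∑ z : EllipticPoint F, (if ellipticForm z.1 v = a ∧ ellipticForm z.1 w = b
      then (1 : ℝ) else 0) = (1 - traceSign (a * b / det₂ v w ^ 2)) / 2 := by
  have h2 := two_eq_zero_of_algebra F
  have htr : ∀ z : F × F, ellipticForm z v = a ∧ ellipticForm z w = b →
      Algebra.trace (ZMod 2) F (z.1 * z.2) =
        Algebra.trace (ZMod 2) F (a * b / det₂ v w ^ 2) := by
    rintro z ⟨rfl, rfl⟩
    rw [trace_ellipticForm_mul z v w h]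
  -- Cramer's rule for `z₁ v₁² + z₂ v₂² = a + v₁ v₂` and its analogue for `w`, `b`; the determinant
  -- of this system is the square of `det₂ v w`.
  set z₀ : F × F := (((a + v.1 * v.2) * w.2 ^ 2 + (b + w.1 * w.2) * v.2 ^ 2) / det₂ v w ^ 2,
    ((a + v.1 * v.2) * w.1 ^ 2 + (b + w.1 * w.2) * v.1 ^ 2) / det₂ v w ^ 2) with hz₀
  have hdet : det₂ v w ^ 2 = v.1 ^ 2 * w.2 ^ 2 + v.2 ^ 2 * w.1 ^ 2 := by
    simp only [det₂]
    linear_combination (v.1 * v.2 * w.1 * w.2) * h2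
  have huniq : ∀ z : F × F, ellipticForm z v = a ∧ ellipticForm z w = b ↔ z = z₀ := by
    intro z
    constructor
    · rintro ⟨rfl, rfl⟩
      refine Prod.ext ?_ ?_
      · rw [hz₀, eq_div_iff (pow_ne_zero 2 h), hdet]
        simp only [ellipticForm]
        linear_combination (-(v.1 * v.2 * w.2 ^ 2 + w.1 * w.2 * v.2 ^ 2 +
          z.2 * v.2 ^ 2 * w.2 ^ 2)) * h2
      · rw [hz₀, eq_div_iff (pow_ne_zero 2 h), hdet]
        simp only [ellipticForm]
        linear_combination (-(v.1 * v.2 * w.1 ^ 2 + w.1 * w.2 * v.1 ^ 2 +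
          z.1 * v.1 ^ 2 * w.1 ^ 2)) * h2
    · rintro rfl
      simp only [hz₀, ellipticForm]
      constructor
      · field_simp
        rw [hdet]
        linear_combination (v.1 ^ 3 * v.2 * w.2 ^ 2 + v.1 * v.2 ^ 3 * w.1 ^ 2 +
          v.1 ^ 2 * v.2 ^ 2 * w.1 * w.2 + v.1 ^ 2 * v.2 ^ 2 * b) * h2
      · field_simp
        rw [hdet]
        linear_combination (v.1 ^ 2 * w.1 * w.2 ^ 3 + v.2 ^ 2 * w.1 ^ 3 * w.2 +
          v.1 * v.2 * w.1 ^ 2 * w.2 ^ 2 + w.1 ^ 2 * w.2 ^ 2 * a) * h2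
  rcases zmodTwo_eq_zero_or_one (Algebra.trace (ZMod 2) F (a * b / det₂ v w ^ 2)) with ht | ht
  · rw [traceSign_of_trace_eq_zero ht, Finset.sum_eq_zero]
    · simp
    · refine fun z _ => if_neg fun hz => ?_
      have := htr z.1 hz
      rw [z.2, ht] at this
      exact one_ne_zero this
  · rw [traceSign_of_trace_eq_one ht]
    have hz₀' : Algebra.trace (ZMod 2) F (z₀.1 * z₀.2) = 1 := by
      rw [htr z₀ ((huniq z₀).2 rfl), ht]
    have : ∀ z : EllipticPoint F, (ellipticForm z.1 v = a ∧ ellipticForm z.1 w = b) ↔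
        z = ⟨z₀, hz₀'⟩ := fun z => by rw [huniq, Subtype.ext_iff]
    simp only [this, Finset.sum_ite_eq', Finset.mem_univ, if_true]
    norm_num

theorem sum_ellipticForm_eq {a : F} (ha : a ≠ 0) {v : F × F} (hv : v ≠ 0) :
    ∑ z : EllipticPoint F, (if ellipticForm z.1 v = a then (1 : ℝ) else 0) =
      Fintype.card F / 2 := by
  obtain ⟨w, hw⟩ := exists_det₂_ne_zero hv
  have h1 : ∀ z : EllipticPoint F, (if ellipticForm z.1 v = a then (1 : ℝ) else 0) =
      ∑ b, if ellipticForm z.1 v = a ∧ ellipticForm z.1 w = b then (1 : ℝ) else 0 := by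
    intro z
    by_cases hz : ellipticForm z.1 v = a <;> simp [hz]
  simp_rw [h1]
  rw [Finset.sum_comm]
  simp_rw [sum_ellipticForm_eq_eq a _ hw]
  have h2 : ∀ b : F, a * b / det₂ v w ^ 2 = b * (a / det₂ v w ^ 2) := fun b => by ring
  rw [← Finset.sum_div, Finset.sum_sub_distrib]
  simp_rw [h2]
  rw [sum_traceSign_mul, if_neg (div_ne_zero ha (pow_ne_zero 2 hw))]
  simp

/-- By anisotropy the value at `(1, 0)` is one of `q - 1` nonzero elements, each attained `q / 2`
times. -/
theorem card_ellipticPoint :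
    (Fintype.card (EllipticPoint F) : ℝ) = Fintype.card F * (Fintype.card F - 1) / 2 := by
  have hv : ((1, 0) : F × F) ≠ 0 := by simp
  have h1 : ∀ z : EllipticPoint F, (1 : ℝ) =
      ∑ a ∈ Finset.univ.erase (0 : F), if ellipticForm z.1 (1, 0) = a then (1 : ℝ) else 0 := by
    intro z
    rw [Finset.sum_ite_eq, if_pos]
    simpa using ellipticForm_ne_zero z hv
  rw [← Finset.card_univ, Finset.cast_card, Finset.sum_congr rfl fun z _ => h1 z,
    Finset.sum_comm, Finset.sum_congr rfl fun a ha =>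
    sum_ellipticForm_eq (Finset.ne_of_mem_erase ha) hv, Finset.sum_const,
    Finset.card_erase_of_mem (Finset.mem_univ _), Finset.card_univ, nsmul_eq_mul,
    Nat.cast_sub Fintype.card_pos]
  push_cast
  ring

theorem formResultant_comm (x y : F × F) : formResultant x y = formResultant y x := by
  simp only [formResultant]
  ring

theorem formResultant_self (x : F × F) : formResultant x x = 0 := by
  have h2 := two_eq_zero_of_algebra F
  simp only [formResultant]
  linear_combination (x.1 ^ 2 * x.2 ^ 2 + 2 * x.1 * x.2) * h2

theorem trace_formResultant (x y : EllipticPoint F) :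
    Algebra.trace (ZMod 2) F (formResultant x.1 y.1) = 0 := by
  have h2 := two_eq_zero_of_algebra F
  have h1 : formResultant x.1 y.1 = ((x.1.1 * y.1.2 + x.1.2 * y.1.1) ^ 2 +
      (x.1.1 * y.1.2 + x.1.2 * y.1.1)) + (x.1.1 * x.1.2 + y.1.1 * y.1.2) := by
    simp only [formResultant]
    linear_combination (-(x.1.1 * y.1.2 * x.1.2 * y.1.1)) * h2
  rw [h1, map_add, (trace_eq_zero_iff _).2 ⟨_, rfl⟩, map_add, x.2, y.2]
  decide

theorem formResultant_eq_zero_iff (x y : EllipticPoint F) :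
    formResultant x.1 y.1 = 0 ↔ x = y := by
  have := charTwo_of_algebra F
  have h2 := two_eq_zero_of_algebra F
  constructor
  · intro h
    -- The resultant is the value at `(x₂ + y₂, x₁ + y₁)` of the form with squared coefficients
    -- `x₁²`, `x₂²`, which is again anisotropic.
    let x' : EllipticPoint F := ⟨(x.1.1 ^ 2, x.1.2 ^ 2), by
      rw [← mul_pow, trace_sq, x.2]⟩
    by_contra hxy
    refine ellipticForm_ne_zero x' (v := (x.1.2 + y.1.2, x.1.1 + y.1.1)) ?_ ?_
    · intro h0
      rw [Prod.mk_eq_zero, CharTwo.add_eq_zero, CharTwo.add_eq_zero] at h0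
      exact hxy (Subtype.ext (Prod.ext h0.2 h0.1))
    · rw [← h]
      simp only [x', ellipticForm, formResultant]
      linear_combination (x.1.1 ^ 2 * x.1.2 ^ 2 + x.1.1 ^ 2 * x.1.2 * y.1.2 +
        x.1.2 ^ 2 * x.1.1 * y.1.1) * h2
  · rintro rfl
    exact formResultant_self _

/-- The number of points of the projective line at which the form of `x` is `c` times the form
of `y`. -/
noncomputable def proportionalCount (c : F) (x y : EllipticPoint F) : ℝ :=
  ∑ v : Option F, if ellipticForm x.1 (projVec v) = c * ellipticForm y.1 (projVec v)
    then 1 else 0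

theorem proportionalCount_one (x y : EllipticPoint F) :
    proportionalCount 1 x y = if x = y then (Fintype.card F + 1 : ℝ) else 1 := by
  have := charTwo_of_algebra F
  have h2 := two_eq_zero_of_algebra F
  split_ifs with h
  · subst h
    simp [proportionalCount]
  · refine Eq.trans ?_ (sum_projVec_sq_form (α := x.1.1 + y.1.1) (γ := x.1.2 + y.1.2) ?_)
    · refine Finset.sum_congr rfl fun v _ => if_congr ?_ rfl rfl
      rw [one_mul, ← CharTwo.add_eq_zero]
      have : ellipticForm x.1 (projVec v) + ellipticForm y.1 (projVec v) =
          (x.1.1 + y.1.1) * (projVec v).1 ^ 2 + (x.1.2 + y.1.2) * (projVec v).2 ^ 2 := by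
        simp only [ellipticForm]
        linear_combination ((projVec v).1 * (projVec v).2) * h2
      rw [this]
    · rintro ⟨h1, h2⟩
      exact h (Subtype.ext (Prod.ext (CharTwo.add_eq_zero.1 h1) (CharTwo.add_eq_zero.1 h2)))

/-- The form `Q_x + c Q_y` has middle coefficient `1 + c ≠ 0`, so its zeros are counted by one trace
sign. Its argument is `ρ / (1 + c)²` plus some `g² + g` plus `y₁ y₂`; the last term has trace 1 and
causes the minus sign. -/
theorem proportionalCount_of_ne_one {c : F} (hc : c ≠ 1) (x y : EllipticPoint F) :
    proportionalCount c x y = 1 - traceSign (((1 + c) ^ 2)⁻¹ * formResultant x.1 y.1) := by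
  have := charTwo_of_algebra F
  have h2 := two_eq_zero_of_algebra F
  have hc' : 1 + c ≠ 0 := fun h => hc (CharTwo.add_eq_zero.1 h).symm
  have h1 : proportionalCount c x y =
      1 + traceSign ((x.1.1 + c * y.1.1) * (x.1.2 + c * y.1.2) / (1 + c) ^ 2) := by
    rw [proportionalCount, ← sum_projVec_form _ _ hc']
    refine Finset.sum_congr rfl fun v _ => if_congr ?_ rfl rfl
    rw [← CharTwo.add_eq_zero]
    simp only [ellipticForm]
    ring_nf
  set w := x.1.1 * y.1.2 + x.1.2 * y.1.1 with hw
  have h3 : (x.1.1 + c * y.1.1) * (x.1.2 + c * y.1.2) / (1 + c) ^ 2 =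
      ((1 + c) ^ 2)⁻¹ * formResultant x.1 y.1 + ((w / (1 + c)) ^ 2 + w / (1 + c)) +
        y.1.1 * y.1.2 := by
    field_simp
    rw [hw]
    simp only [formResultant]
    linear_combination (-(x.1.1 ^ 2 * y.1.2 ^ 2 + x.1.2 ^ 2 * y.1.1 ^ 2 +
      x.1.1 * x.1.2 * y.1.1 * y.1.2 + x.1.1 * y.1.2 + x.1.2 * y.1.1 + y.1.1 * y.1.2
      + c * y.1.1 * y.1.2)) * h2
  rw [h1, h3, traceSign_add, traceSign_add, traceSign_sq_add, traceSign_of_trace_eq_one y.2]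
  ring

theorem proportionalCount_comm (c : F) (x y : EllipticPoint F) :
    proportionalCount c x y = proportionalCount c y x := by
  by_cases hc : c = 1
  · subst hc
    simp [proportionalCount_one, eq_comm]
  · rw [proportionalCount_of_ne_one hc, proportionalCount_of_ne_one hc, formResultant_comm]

theorem proportionalCount_congr (c : F) {x y x' y' : EllipticPoint F}
    (h : formResultant x.1 y.1 = formResultant x'.1 y'.1) :
    proportionalCount c x y = proportionalCount c x' y' := by
  by_cases hc : c = 1
  · subst hc
    simp only [proportionalCount_one, ← formResultant_eq_zero_iff, h]
  · rw [proportionalCount_of_ne_one hc, proportionalCount_of_ne_one hc, h]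

theorem sum_proportionalCount {c : F} (hc : c ≠ 0) (y : EllipticPoint F) :
    ∑ z, proportionalCount c z y = Fintype.card F * (Fintype.card F + 1) / 2 := by
  simp only [proportionalCount]
  rw [Finset.sum_comm, Finset.sum_congr rfl fun v _ => sum_ellipticForm_eq
    (mul_ne_zero hc (ellipticForm_ne_zero y (projVec_ne_zero v))) (projVec_ne_zero v)]
  simp
  ring

/-- An auxiliary quantity, shown below to be an affine function of `proportionalCount`. -/
noncomputable def offDiagonalCount (c : F) (x y : EllipticPoint F) : ℝ :=
  ∑ v : Option F, ∑ w : Option F, if v = w then 0 else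
    (1 - traceSign (c * ellipticForm x.1 (projVec v) * ellipticForm y.1 (projVec w) /
      det₂ (projVec v) (projVec w) ^ 2)) / 2

/-- The product counts pairs of points `v`, `w` at which the values of `z` are prescribed. For `v =
w` the conditions are compatible exactly when `Q_x(v) = c d Q_y(v)`; for `v ≠ w` only the ratio `d /
c` enters. -/
theorem sum_proportionalCount_mul_aux {c d : F} (hc : c ≠ 0) (hd : d ≠ 0)
    (x y : EllipticPoint F) :
    ∑ z, proportionalCount c x z * proportionalCount d z y =
      Fintype.card F / 2 * proportionalCount (c * d) x y + offDiagonalCount (c⁻¹ * d) x y := by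
  have h1 : ∀ z, proportionalCount c x z * proportionalCount d z y =
      ∑ v : Option F, ∑ w : Option F,
        if ellipticForm z.1 (projVec v) = c⁻¹ * ellipticForm x.1 (projVec v) ∧
          ellipticForm z.1 (projVec w) = d * ellipticForm y.1 (projVec w)
        then (1 : ℝ) else 0 := by
    intro z
    rw [proportionalCount, proportionalCount, Finset.sum_mul_sum]
    refine Finset.sum_congr rfl fun v _ => Finset.sum_congr rfl fun w _ => ?_
    rw [ite_zero_mul_ite_zero, one_mul]
    refine if_congr (and_congr ?_ Iff.rfl) rfl rfl
    rw [eq_inv_mul_iff_mul_eq₀ hc, eq_comm]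
  have h2 : ∀ v w : Option F,
      (∑ z : EllipticPoint F,
        if ellipticForm z.1 (projVec v) = c⁻¹ * ellipticForm x.1 (projVec v) ∧
          ellipticForm z.1 (projVec w) = d * ellipticForm y.1 (projVec w)
        then (1 : ℝ) else 0) =
      (if v = w then Fintype.card F / 2 * (if ellipticForm x.1 (projVec v) =
        c * d * ellipticForm y.1 (projVec v) then (1 : ℝ) else 0) else 0) +
      if v = w then 0 else (1 - traceSign (c⁻¹ * d * ellipticForm x.1 (projVec v) *
        ellipticForm y.1 (projVec w) / det₂ (projVec v) (projVec w) ^ 2)) / 2 := by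
    intro v w
    by_cases hvw : v = w
    · subst hvw
      rw [if_pos rfl, if_pos rfl, add_zero]
      split_ifs with h
      · rw [mul_one, ← sum_ellipticForm_eq (a := d * ellipticForm y.1 (projVec v))
          (mul_ne_zero hd (ellipticForm_ne_zero y (projVec_ne_zero v))) (projVec_ne_zero v)]
        refine Finset.sum_congr rfl fun z _ => if_congr ?_ rfl rfl
        rw [h, mul_assoc, inv_mul_cancel_left₀ hc, and_self]
      · rw [mul_zero]
        refine Finset.sum_eq_zero fun z _ => if_neg ?_
        rintro ⟨h3, h4⟩
        rw [h4, eq_inv_mul_iff_mul_eq₀ hc, ← mul_assoc] at h3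
        exact h h3.symm
    · rw [if_neg hvw, if_neg hvw, zero_add,
        sum_ellipticForm_eq_eq _ _ (fun h0 => hvw ((det₂_projVec_eq_zero v w).1 h0))]
      congr 4
      ring
  simp_rw [h1]
  rw [Finset.sum_comm]
  rw [Finset.sum_congr rfl fun v _ => Finset.sum_comm]
  simp_rw [h2, Finset.sum_add_distrib]
  congr 1
  simp_rw [Finset.sum_ite_eq, if_pos (Finset.mem_univ _), ← Finset.mul_sum]
  rfl

/-- The multiplication table of the matrices `proportionalCount c`. -/
theorem sum_proportionalCount_mul {c d : F} (hc : c ≠ 0) (hd : d ≠ 0)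
    (x y : EllipticPoint F) :
    ∑ z, proportionalCount c x z * proportionalCount d z y =
      Fintype.card F / 2 * (proportionalCount (c * d) x y + proportionalCount (c⁻¹ * d) x y) +
        Fintype.card F * (Fintype.card F + 1) / 2 := by
  -- The off-diagonal part depends only on `d / c`, so it can be read off from `c = 1`, where the
  -- product is known because `P_1 = q I + J`.
  have key : ∀ e : F, e ≠ 0 → offDiagonalCount e x y =
      Fintype.card F / 2 * proportionalCount e x y +
        Fintype.card F * (Fintype.card F + 1) / 2 := by
    intro e he
    have h1 := sum_proportionalCount_mul_aux one_ne_zero he x y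
    have h2 : ∀ z, proportionalCount 1 x z * proportionalCount e z y = proportionalCount e z y +
        if x = z then Fintype.card F * proportionalCount e z y else 0 := by
      intro z
      rw [proportionalCount_one]
      split_ifs <;> ring
    simp_rw [h2, Finset.sum_add_distrib] at h1
    rw [sum_proportionalCount he, Finset.sum_ite_eq, if_pos (Finset.mem_univ _), one_mul, inv_one,
      one_mul] at h1
    linarith
  rw [sum_proportionalCount_mul_aux hc hd, key _ (mul_ne_zero (inv_ne_zero hc) hd)]
  ring

end EllipticPoints

/-! ### Fourier inversion in the resultant and counts of triangles. -/

section FourierCounting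

variable {F : Type*} [Field F] [Fintype F] [Algebra (ZMod 2) F]

open Classical

/-- The bijection `c ↦ (1 + c)⁻²` of the field. -/
def dualParam (c : F) : F := ((1 + c) ^ 2)⁻¹

theorem bijective_dualParam : Function.Bijective (dualParam : F → F) :=
  inv_involutive.bijective.comp ((bijective_sq (F := F)).comp (Equiv.addLeft (1 : F)).bijective)

theorem dualParam_zero : dualParam (0 : F) = 1 := by simp [dualParam]

theorem dualParam_one : dualParam (1 : F) = 0 := by
  have h2 := two_eq_zero_of_algebra F
  simp [dualParam, one_add_one_eq_two, h2]

theorem dualParam_pow_two_pow (c : F) (j : ℕ) : dualParam (c ^ 2 ^ j) = dualParam c ^ 2 ^ j := by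
  have := charTwo_of_algebra F
  have : ExpChar F 2 := ExpChar.prime Nat.prime_two
  rw [dualParam, dualParam, inv_pow, ← pow_mul, mul_comm 2, pow_mul, add_pow_expChar_pow, one_pow]

theorem sum_traceSign_dualParam_mul_add (s t : F) :
    ∑ c : F, traceSign (dualParam c * (s + t)) = if s = t then (Fintype.card F : ℝ) else 0 := by
  rw [← sum_traceSign_mul_add]
  exact bijective_dualParam.sum_comp fun e => traceSign (e * (s + t))

theorem ite_eq_sum_traceSign (s t : F) : (if s = t then (1 : ℝ) else 0) =
    (Fintype.card F : ℝ)⁻¹ * ∑ c : F, traceSign (dualParam c * t) * traceSign (dualParam c * s) := by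
  have hq : (Fintype.card F : ℝ) ≠ 0 := by exact_mod_cast Fintype.card_ne_zero
  simp_rw [← traceSign_add, ← mul_add]
  rw [sum_traceSign_dualParam_mul_add, if_congr (eq_comm (a := t)) rfl rfl]
  split_ifs <;> simp [hq]

/-- Resultants have trace 0, so two parameters give the trivial character on them: `c = 1`, with
multiplier 0, and `c = 0`, with multiplier 1. -/
theorem traceSign_dualParam_of_mem {c : F} (hc : c = 0 ∨ c = 1) (x y : EllipticPoint F) :
    traceSign (dualParam c * formResultant x.1 y.1) = 1 := by
  rcases hc with rfl | rfl
  · rw [dualParam_zero, one_mul, traceSign_of_trace_eq_zero (trace_formResultant x y)]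
  · rw [dualParam_one, zero_mul, traceSign_zero]

theorem traceSign_dualParam {c : F} (hc : c ≠ 1) (x y : EllipticPoint F) :
    traceSign (dualParam c * formResultant x.1 y.1) = 1 - proportionalCount c x y := by
  rw [proportionalCount_of_ne_one hc, dualParam]
  ring

theorem sum_traceSign_dualParam (c : F) (x : EllipticPoint F) :
    ∑ z : EllipticPoint F, traceSign (dualParam c * formResultant x.1 z.1) =
      if c = 0 ∨ c = 1 then (Fintype.card F * (Fintype.card F - 1) / 2 : ℝ)
        else -(Fintype.card F : ℝ) := by
  split_ifs with hc
  · simp [traceSign_dualParam_of_mem hc, ← card_ellipticPoint]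
  · push Not at hc
    simp_rw [traceSign_dualParam hc.2, Finset.sum_sub_distrib, proportionalCount_comm c x]
    rw [sum_proportionalCount hc.1]
    simp only [Finset.sum_const, Finset.card_univ, nsmul_eq_mul, card_ellipticPoint, mul_one]
    ring

theorem sum_traceSign_dualParam_mul {c d : F} (hc : c ≠ 0) (hc' : c ≠ 1) (hd : d ≠ 0)
    (hd' : d ≠ 1) (x y : EllipticPoint F) :
    ∑ z : EllipticPoint F, traceSign (dualParam c * formResultant x.1 z.1) *
      traceSign (dualParam d * formResultant z.1 y.1) =
        -(Fintype.card F : ℝ) + Fintype.card F / 2 *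
          (proportionalCount (c * d) x y + proportionalCount (c⁻¹ * d) x y) := by
  simp_rw [traceSign_dualParam hc', traceSign_dualParam hd', sub_mul, mul_sub, one_mul, mul_one,
    Finset.sum_sub_distrib, sum_proportionalCount_mul hc hd, sum_proportionalCount hd,
    proportionalCount_comm c x, sum_proportionalCount hc]
  simp only [Finset.sum_const, Finset.card_univ, nsmul_eq_mul, card_ellipticPoint, mul_one]
  ring

/-- The elliptic relations have intersection numbers. -/
theorem sum_formResultant_congr (h h' : F → ℝ) {x y x' y' : EllipticPoint F}
    (hxy : formResultant x.1 y.1 = formResultant x'.1 y'.1) :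
    ∑ z : EllipticPoint F, h (formResultant x.1 z.1) * h' (formResultant z.1 y.1) =
      ∑ z : EllipticPoint F, h (formResultant x'.1 z.1) * h' (formResultant z.1 y'.1) := by
  -- Every function on the field is a combination of additive characters, so only products of two
  -- characters need be summed over `z`.
  have hexp : ∀ h : F → ℝ, ∃ a : F → ℝ, ∀ t, h t = ∑ c, a c * traceSign (dualParam c * t) := by
    intro h
    refine ⟨fun c => ∑ s, h s * ((Fintype.card F : ℝ)⁻¹ * traceSign (dualParam c * s)), fun t => ?_⟩
    calc h t = ∑ s, h s * (if t = s then 1 else 0) := by simp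
      _ = ∑ s, ∑ c, h s * ((Fintype.card F : ℝ)⁻¹ * traceSign (dualParam c * s)) *
          traceSign (dualParam c * t) := by
        refine Finset.sum_congr rfl fun s _ => ?_
        rw [ite_eq_sum_traceSign, Finset.mul_sum, Finset.mul_sum]
        exact Finset.sum_congr rfl fun c _ => by ring
      _ = _ := by
        rw [Finset.sum_comm]
        simp_rw [Finset.sum_mul]
  obtain ⟨a, ha⟩ := hexp h
  obtain ⟨a', ha'⟩ := hexp h'
  have hS : ∀ x y : EllipticPoint F,
      ∑ z : EllipticPoint F, h (formResultant x.1 z.1) * h' (formResultant z.1 y.1) =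
        ∑ c, ∑ d, a c * a' d * ∑ z : EllipticPoint F,
          traceSign (dualParam c * formResultant x.1 z.1) *
            traceSign (dualParam d * formResultant z.1 y.1) := by
    intro x y
    simp_rw [ha, ha', Finset.sum_mul_sum, Finset.mul_sum]
    rw [Finset.sum_comm]
    refine Finset.sum_congr rfl fun c _ => ?_
    rw [Finset.sum_comm]
    exact Finset.sum_congr rfl fun d _ => Finset.sum_congr rfl fun z _ => by ring
  rw [hS, hS]
  refine Finset.sum_congr rfl fun c _ => Finset.sum_congr rfl fun d _ => ?_
  congr 1
  by_cases hc : c = 0 ∨ c = 1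
  · simp_rw [traceSign_dualParam_of_mem hc, one_mul, fun z => formResultant_comm (z : F × F) y.1,
      fun z => formResultant_comm (z : F × F) y'.1, sum_traceSign_dualParam]
  · by_cases hd : d = 0 ∨ d = 1
    · simp_rw [traceSign_dualParam_of_mem hd, mul_one, sum_traceSign_dualParam]
    · push Not at hc hd
      rw [sum_traceSign_dualParam_mul hc.1 hc.2 hd.1 hd.2,
        sum_traceSign_dualParam_mul hc.1 hc.2 hd.1 hd.2, proportionalCount_congr _ hxy,
        proportionalCount_congr _ hxy]

/-- The valencies of the elliptic relations. -/
theorem sum_formResultant_eq {a : F} (ha : a ≠ 0) (ha' : Algebra.trace (ZMod 2) F a = 0)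
    (x : EllipticPoint F) :
    ∑ z : EllipticPoint F, (if formResultant x.1 z.1 = a then (1 : ℝ) else 0) =
      Fintype.card F + 1 := by
  have hq : (Fintype.card F : ℝ) ≠ 0 := by exact_mod_cast Fintype.card_ne_zero
  simp_rw [ite_eq_sum_traceSign]
  rw [← Finset.mul_sum, Finset.sum_comm]
  simp_rw [← Finset.mul_sum, sum_traceSign_dualParam]
  -- The weight is `-q` for every character, plus an excess `n + q = q(q+1)/2` at the two trivial
  -- ones; the uniform part sums to 0 because `a ≠ 0`.
  have h1 : ∀ c : F, traceSign (dualParam c * a) * (if c = 0 ∨ c = 1 then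
      (Fintype.card F * (Fintype.card F - 1) / 2 : ℝ) else -(Fintype.card F : ℝ)) =
      -(Fintype.card F : ℝ) * traceSign (dualParam c * (a + 0)) +
      ((if c = 0 then (Fintype.card F * (Fintype.card F + 1) / 2 : ℝ) else 0) +
      if c = 1 then (Fintype.card F * (Fintype.card F + 1) / 2 : ℝ) else 0) := by
    intro c
    rw [add_zero]
    by_cases h0 : c = 0
    · subst h0
      simp only [dualParam_zero, one_mul, traceSign_of_trace_eq_zero ha', true_or, if_true,
        zero_ne_one, if_false]
      ring
    · by_cases h1 : c = 1
      · subst h1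
        simp only [dualParam_one, zero_mul, traceSign_zero, or_true, if_true,
          one_ne_zero, if_false]
        ring
      · simp [h0, h1]
        ring
  simp_rw [h1, Finset.sum_add_distrib, ← Finset.mul_sum, sum_traceSign_dualParam_mul_add]
  simp [ha]

theorem sum_eq_zero_add_sum_units (g : F → ℝ) : ∑ c, g c = g 0 + ∑ u : Fˣ, g u := by
  rw [Fintype.sum_eq_add_sum_subtype_ne g 0]
  congr 1
  exact (Equiv.sum_comp unitsEquivNeZero fun c : {c : F // c ≠ 0} => g c).symm

/-- At each of the `q + 1` points both forms are nonzero, so exactly one ratio `u` occurs. -/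
theorem sum_units_proportionalCount (x y : EllipticPoint F) :
    ∑ u : Fˣ, proportionalCount (u : F) x y = Fintype.card F + 1 := by
  simp only [proportionalCount]
  rw [Finset.sum_comm]
  have : ∀ v : Option F, (∑ u : Fˣ, if ellipticForm x.1 (projVec v) =
      u * ellipticForm y.1 (projVec v) then (1 : ℝ) else 0) = 1 := by
    intro v
    have hx := ellipticForm_ne_zero x (projVec_ne_zero v)
    have hy := ellipticForm_ne_zero y (projVec_ne_zero v)
    have h1 : ∀ u : Fˣ, ellipticForm x.1 (projVec v) = u * ellipticForm y.1 (projVec v) ↔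
        u = Units.mk0 _ (div_ne_zero hx hy) := by
      intro u
      rw [Units.ext_iff, Units.val_mk0, eq_div_iff hy, eq_comm]
    simp [h1]
  simp [this]

/-- A Frobenius-twisted count of isosceles triangles over a fixed base, reduced to a sum over
the multiplicative group. -/
theorem sum_formResultant_eq_pow (j : ℕ) {x y : EllipticPoint F} (hxy : x ≠ y) :
    ∑ z : EllipticPoint F, (if formResultant z.1 y.1 = formResultant x.1 z.1 ^ 2 ^ j
      then (1 : ℝ) else 0) =
      ((∑ u : Fˣ, proportionalCount ((u * u ^ 2 ^ j : Fˣ) : F) x y) +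
        ∑ u : Fˣ, proportionalCount ((u⁻¹ * u ^ 2 ^ j : Fˣ) : F) x y) / 2 := by
  have hq : (Fintype.card F : ℝ) ≠ 0 := by exact_mod_cast Fintype.card_ne_zero
  have h1 : ∀ z : EllipticPoint F, (if formResultant z.1 y.1 = formResultant x.1 z.1 ^ 2 ^ j
      then (1 : ℝ) else 0) = (Fintype.card F : ℝ)⁻¹ * ∑ c : F,
        traceSign (dualParam c * formResultant x.1 z.1) *
          traceSign (dualParam (c ^ 2 ^ j) * formResultant z.1 y.1) := by
    intro z
    rw [ite_eq_sum_traceSign]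
    congr 1
    -- Reindexing by Frobenius and using the invariance of the trace removes the power from the
    -- resultant and puts it on the parameter `c`.
    rw [← (bijective_pow_two_pow (F := F) j).sum_comp]
    refine Finset.sum_congr rfl fun c _ => ?_
    rw [dualParam_pow_two_pow, ← mul_pow, traceSign_pow_two_pow]
  simp_rw [h1]
  rw [← Finset.mul_sum, Finset.sum_comm, sum_eq_zero_add_sum_units]
  have h0 : ∑ z : EllipticPoint F, traceSign (dualParam (0 : F) * formResultant x.1 z.1) *
      traceSign (dualParam ((0 : F) ^ 2 ^ j) * formResultant z.1 y.1) =
      (Fintype.card F * (Fintype.card F - 1) / 2 : ℝ) := by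
    rw [zero_pow (by positivity)]
    simp_rw [traceSign_dualParam_of_mem (Or.inl rfl)]
    simp [card_ellipticPoint]
  -- At `u = 1` both characters are trivial and the sum is `n`, while the general formula would give
  -- 0 since `P_1(x,y) = 1`. Together with the term `c = 0`, the excess `2 n = q (q - 1)` cancels
  -- the constants `-q` over the `q - 1` units.
  have h2 : ∀ u : Fˣ, ∑ z : EllipticPoint F,
      traceSign (dualParam (u : F) * formResultant x.1 z.1) *
        traceSign (dualParam ((u : F) ^ 2 ^ j) * formResultant z.1 y.1) =
      -(Fintype.card F : ℝ) + Fintype.card F / 2 *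
        (proportionalCount ((u * u ^ 2 ^ j : Fˣ) : F) x y +
          proportionalCount ((u⁻¹ * u ^ 2 ^ j : Fˣ) : F) x y) +
      if u = 1 then (Fintype.card F * (Fintype.card F - 1) / 2 : ℝ) else 0 := by
    intro u
    split_ifs with hu
    · subst hu
      simp only [Units.val_one, one_pow, inv_one, mul_one, proportionalCount_one, if_neg hxy]
      simp_rw [traceSign_dualParam_of_mem (Or.inr rfl)]
      simp [card_ellipticPoint]
      ring
    · have hu1 : (u : F) ≠ 1 := fun h => hu (Units.ext h)
      have hu2 : (u : F) ^ 2 ^ j ≠ 1 := fun h => hu1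
        ((bijective_pow_two_pow (F := F) j).1 (by dsimp only; rw [h, one_pow]))
      rw [sum_traceSign_dualParam_mul u.ne_zero hu1 (pow_ne_zero _ u.ne_zero) hu2, add_zero]
      simp
  rw [h0]
  simp_rw [h2, Finset.sum_add_distrib, ← Finset.mul_sum, Finset.sum_add_distrib]
  simp only [Finset.sum_const, Finset.card_univ, nsmul_eq_mul, Finset.sum_ite_eq', Finset.mem_univ,
    if_true, Fintype.card_units, Nat.cast_sub (show 1 ≤ Fintype.card F from Fintype.card_pos),
    Nat.cast_one]
  field_simp
  ring

theorem sum_units_proportionalCount_pow {k : ℕ} (hk : (Fintype.card F - 1).Coprime k)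
    (x y : EllipticPoint F) :
    ∑ u : Fˣ, proportionalCount ((u ^ k : Fˣ) : F) x y = Fintype.card F + 1 := by
  rw [← sum_units_proportionalCount x y]
  have hk' : (Nat.card Fˣ).Coprime k := by rwa [Nat.card_eq_fintype_card, Fintype.card_units]
  exact Equiv.sum_comp (powCoprime hk') fun u => proportionalCount (u : F) x y

/-- Here the two exponents are 2 and 0: squaring permutes the units and contributes `q + 1`, whereas
exponent 0 contributes `q - 1` copies of `P_1(x,y) = 1`. -/
theorem sum_formResultant_eq_self {x y : EllipticPoint F} (hxy : x ≠ y) :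
    ∑ z : EllipticPoint F, (if formResultant z.1 y.1 = formResultant x.1 z.1
      then (1 : ℝ) else 0) = Fintype.card F := by
  have h := sum_formResultant_eq_pow 0 hxy
  simp only [pow_zero, pow_one, inv_mul_cancel, Units.val_one, proportionalCount_one, if_neg hxy,
    ← sq] at h
  have hodd : (Fintype.card F - 1).Coprime 2 := by
    have : (2 : ℕ) ∣ Fintype.card F := by
      have := charTwo_of_algebra F
      rw [← CharP.cast_eq_zero_iff F 2]
      exact FiniteField.cast_card_eq_zero F
    have : 0 < Fintype.card F := Fintype.card_pos
    rw [Nat.coprime_two_right, Nat.odd_iff]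
    omega
  rw [h, sum_units_proportionalCount_pow hodd]
  simp [Fintype.card_units, Nat.cast_sub (show 1 ≤ Fintype.card F from Fintype.card_pos)]

theorem sum_formResultant_eq_pow_of_lt {m : ℕ} (hm : m.Prime) (hodd : Odd m)
    (hF : Fintype.card F = 2 ^ m) {j : ℕ} (hj : 0 < j) (hjm : j < m)
    {x y : EllipticPoint F} (hxy : x ≠ y) :
    ∑ z : EllipticPoint F, (if formResultant z.1 y.1 = formResultant x.1 z.1 ^ 2 ^ j
      then (1 : ℝ) else 0) = Fintype.card F + 1 := by
  have hcop : m.Coprime j := Nat.coprime_of_lt_prime hj.ne' hjm hm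
  have h1 : (Fintype.card F - 1).Coprime (2 ^ j - 1) := by
    rw [hF, Nat.Coprime, Nat.pow_sub_one_gcd_pow_sub_one, hcop]
    norm_num
  -- `2^j + 1` divides `2^(2j) - 1`, and `gcd(m, 2j) = 1` because `m` is odd.
  have h2 : (Fintype.card F - 1).Coprime (2 ^ j + 1) := by
    have h3 : (Fintype.card F - 1).Coprime (2 ^ (j * 2) - 1) := by
      rw [hF, Nat.Coprime, Nat.pow_sub_one_gcd_pow_sub_one,
        (hcop.mul_right (Nat.coprime_two_right.2 hodd) : m.gcd (j * 2) = 1)]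
      norm_num
    refine h3.coprime_dvd_right ⟨2 ^ j - 1, ?_⟩
    rw [← Nat.sq_sub_sq, pow_mul, one_pow]
  rw [sum_formResultant_eq_pow j hxy]
  have h4 : ∀ u : Fˣ, u * u ^ 2 ^ j = u ^ (2 ^ j + 1) := fun u => by rw [pow_succ']
  have h5 : ∀ u : Fˣ, u⁻¹ * u ^ 2 ^ j = u ^ (2 ^ j - 1) := fun u => by
    rw [inv_mul_eq_iff_eq_mul, ← pow_succ', Nat.sub_add_cancel Nat.one_le_two_pow]
  simp_rw [h4, h5, sum_units_proportionalCount_pow h1, sum_units_proportionalCount_pow h2]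
  ring

end FourierCounting

/-! ### Fusion of the relations along Frobenius orbits. -/

section FusionColoring

variable {F : Type*} [Field F] [Fintype F] [Algebra (ZMod 2) F]

open Classical

/-- The orbit of an element under the Frobenius automorphism. -/
def frobeniusOrbit (a : F) : Set F := Set.range fun i : ℕ => a ^ 2 ^ i

theorem exists_lt_of_mem_frobeniusOrbit {m : ℕ} (hm : 0 < m) (hF : Fintype.card F = 2 ^ m)
    {a b : F} (h : b ∈ frobeniusOrbit a) : ∃ j < m, b = a ^ 2 ^ j := by
  obtain ⟨i, rfl⟩ := h
  refine ⟨i % m, Nat.mod_lt _ hm, ?_⟩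
  have h1 : ∀ k, (a ^ 2 ^ (m * k)) = a := by
    intro k
    rw [pow_mul, ← hF, FiniteField.pow_card_pow]
  dsimp only
  conv_lhs => rw [← Nat.div_add_mod i m, pow_add, pow_mul, h1]

theorem frobeniusOrbit_eq_iff {m : ℕ} (hm : 0 < m) (hF : Fintype.card F = 2 ^ m) {a b : F} :
    frobeniusOrbit a = frobeniusOrbit b ↔ ∃ j < m, b = a ^ 2 ^ j := by
  constructor
  · intro h
    apply exists_lt_of_mem_frobeniusOrbit hm hF
    rw [h]
    exact ⟨0, by simp⟩
  · rintro ⟨j, hj, rfl⟩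
    have h1 : (a ^ 2 ^ j) ^ 2 ^ (m - j) = a := by
      rw [← pow_mul, ← pow_add, Nat.add_sub_cancel' hj.le, ← hF, FiniteField.pow_card]
    ext c
    constructor
    · rintro ⟨i, rfl⟩
      refine ⟨m - j + i, ?_⟩
      dsimp only
      rw [pow_add, pow_mul, h1]
    · rintro ⟨i, rfl⟩
      refine ⟨j + i, ?_⟩
      dsimp only
      rw [pow_add, pow_mul]

theorem trace_one_of_odd {m : ℕ} (hodd : Odd m) (hF : Fintype.card F = 2 ^ m) :
    Algebra.trace (ZMod 2) F 1 = 1 := by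
  have h1 : Module.finrank (ZMod 2) F = m := by
    have := Module.card_eq_pow_finrank (K := ZMod 2) (V := F)
    rw [hF, ZMod.card] at this
    exact (Nat.pow_right_injective le_rfl this).symm
  have h2 := Algebra.trace_algebraMap (S := F) (1 : ZMod 2)
  rw [map_one, h1] at h2
  rw [h2, nsmul_eq_mul, mul_one]
  exact (ZMod.natCast_eq_one_iff_odd).2 hodd

/-- The period of `a` under squaring divides the prime `m`, and it is 1 only for the fixed points 0
and 1. -/
theorem pow_two_pow_injective_of_lt {m : ℕ} (hm : m.Prime) (hF : Fintype.card F = 2 ^ m) {a : F}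
    (ha0 : a ≠ 0) (ha1 : a ≠ 1) {i j : ℕ} (hi : i < m) (hj : j < m)
    (h : a ^ 2 ^ i = a ^ 2 ^ j) : i = j := by
  have hit : ∀ n, (fun t : F => t ^ 2)^[n] a = a ^ 2 ^ n := by
    intro n
    induction n with
    | zero => simp
    | succ n ih => rw [Function.iterate_succ_apply', ih, ← pow_mul, pow_succ]
  have hper : Function.IsPeriodicPt (fun t : F => t ^ 2) m a := by
    rw [Function.IsPeriodicPt, Function.IsFixedPt, hit, ← hF, FiniteField.pow_card]
  have hmin : Function.minimalPeriod (fun t : F => t ^ 2) a = m := by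
    refine ((Nat.dvd_prime hm).1 hper.minimalPeriod_dvd).resolve_left fun h1 => ?_
    rw [Function.minimalPeriod_eq_one_iff_isFixedPt] at h1
    have h2 : a * (a - 1) = 0 := by
      have : a ^ 2 = a := h1
      linear_combination this
    rcases mul_eq_zero.1 h2 with h3 | h3
    · exact ha0 h3
    · exact ha1 (sub_eq_zero.1 h3)
  refine Function.iterate_injOn_Iio_minimalPeriod (f := fun t : F => t ^ 2) (x := a) ?_ ?_ ?_
  · simpa [hmin] using hi
  · simpa [hmin] using hj
  · simpa [hit] using h

/-- The orbit of `a` is listed without repetition, except when `a = 0`: there a match with `b = 0`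
would be counted `m` times, hence the last hypothesis. -/
theorem ite_frobeniusOrbit_eq {m : ℕ} (hm : m.Prime) (hF : Fintype.card F = 2 ^ m) {a b : F}
    (ha1 : a ≠ 1) (hab : a = 0 → b ≠ 0) :
    (if frobeniusOrbit a = frobeniusOrbit b then (1 : ℝ) else 0) =
      ∑ j ∈ Finset.range m, if b = a ^ 2 ^ j then 1 else 0 := by
  split_ifs with h
  · obtain ⟨j, hj, rfl⟩ := (frobeniusOrbit_eq_iff hm.pos hF).1 h
    have ha0 : a ≠ 0 := fun h0 => hab h0 (by rw [h0, zero_pow (by positivity)])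
    rw [Finset.sum_eq_single j, if_pos rfl]
    · intro i hi hij
      exact if_neg fun h' => hij
        (pow_two_pow_injective_of_lt hm hF ha0 ha1 (Finset.mem_range.1 hi) hj h'.symm)
    · exact fun h' => absurd (Finset.mem_range.2 hj) h'
  · rw [Finset.sum_eq_zero]
    exact fun j hj => if_neg fun h' =>
      h ((frobeniusOrbit_eq_iff hm.pos hF).2 ⟨j, Finset.mem_range.1 hj, h'⟩)

theorem ne_one_of_trace_eq_zero {m : ℕ} (hodd : Odd m) (hF : Fintype.card F = 2 ^ m) {a : F}
    (ha : Algebra.trace (ZMod 2) F a = 0) : a ≠ 1 := by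
  rintro rfl
  rw [trace_one_of_odd hodd hF] at ha
  exact one_ne_zero ha

/-- The action of the Frobenius automorphism on the elliptic points. -/
def EllipticPoint.frobenius (j : ℕ) (x : EllipticPoint F) : EllipticPoint F :=
  ⟨(x.1.1 ^ 2 ^ j, x.1.2 ^ 2 ^ j), by rw [← mul_pow, trace_pow_two_pow, x.2]⟩

theorem EllipticPoint.bijective_frobenius (j : ℕ) :
    Function.Bijective (EllipticPoint.frobenius (F := F) j) := by
  refine Finite.injective_iff_bijective.1 fun x y h => ?_
  have h1 := congrArg Subtype.val h
  exact Subtype.ext (Prod.ext ((bijective_pow_two_pow j).1 (congrArg Prod.fst h1))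
    ((bijective_pow_two_pow j).1 (congrArg Prod.snd h1)))

theorem formResultant_frobenius (j : ℕ) (x y : EllipticPoint F) :
    formResultant (x.frobenius j).1 (y.frobenius j).1 = formResultant x.1 y.1 ^ 2 ^ j := by
  have := charTwo_of_algebra F
  have : ExpChar F 2 := ExpChar.prime Nat.prime_two
  simp only [formResultant, EllipticPoint.frobenius, add_pow_expChar_pow, mul_pow]
  ring

/-- The Frobenius orbits of the resultants form a pseudocyclic coloring. -/
theorem isPseudocyclicColoring_formResultant {m : ℕ} (hm : m.Prime) (hodd : Odd m)
    (hF : Fintype.card F = 2 ^ m) :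
    IsPseudocyclicColoring
      (fun x y : EllipticPoint F => frobeniusOrbit (formResultant x.1 y.1))
      (m * (Fintype.card F + 1)) := by
  have hne1 : ∀ x y : EllipticPoint F, formResultant x.1 y.1 ≠ 1 := fun x y =>
    ne_one_of_trace_eq_zero hodd hF (trace_formResultant x y)
  constructor
  · intro x y
    rw [formResultant_comm]
  · intro x y z
    rw [formResultant_self, eq_comm, frobeniusOrbit_eq_iff hm.pos hF, ← formResultant_eq_zero_iff]
    constructor
    · rintro ⟨j, -, h⟩
      rw [h, zero_pow (by positivity)]
    · intro h
      exact ⟨0, hm.pos, by rw [h]; simp⟩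
  · intro A B x y x' y' h
    obtain ⟨j, -, hj⟩ := (frobeniusOrbit_eq_iff hm.pos hF).1 h
    -- Applying Frobenius to both points turns equality of orbits into equality of resultants, where
    -- the unfused intersection numbers apply.
    rw [← formResultant_frobenius] at hj
    have hcount : ∀ x y : EllipticPoint F, ((Finset.univ.filter fun z : EllipticPoint F =>
        frobeniusOrbit (formResultant x.1 z.1) = A ∧
          frobeniusOrbit (formResultant z.1 y.1) = B).card : ℝ) =
        ∑ z : EllipticPoint F, (fun t => if frobeniusOrbit t = A then (1 : ℝ) else 0)
          (formResultant x.1 z.1) * (fun t => if frobeniusOrbit t = B then (1 : ℝ) else 0)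
          (formResultant z.1 y.1) := by
      intro x y
      rw [← Finset.sum_boole]
      refine Finset.sum_congr rfl fun z _ => ?_
      dsimp only
      rw [ite_zero_mul_ite_zero, one_mul]
    have horb : ∀ t : F, frobeniusOrbit (t ^ 2 ^ j) = frobeniusOrbit t := by
      intro t
      obtain ⟨i, hi, h⟩ := exists_lt_of_mem_frobeniusOrbit hm.pos hF
        (⟨j, rfl⟩ : t ^ 2 ^ j ∈ frobeniusOrbit t)
      exact ((frobeniusOrbit_eq_iff hm.pos hF).2 ⟨i, hi, h⟩).symm
    have hcard : (Finset.univ.filter fun z : EllipticPoint F =>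
        frobeniusOrbit (formResultant x.1 z.1) = A ∧
          frobeniusOrbit (formResultant z.1 y.1) = B).card =
        (Finset.univ.filter fun z : EllipticPoint F =>
          frobeniusOrbit (formResultant x'.1 z.1) = A ∧
            frobeniusOrbit (formResultant z.1 y'.1) = B).card := by
      apply Nat.cast_injective (R := ℝ)
      rw [hcount, hcount]
      refine Eq.trans (Eq.trans ?_ ((EllipticPoint.bijective_frobenius j).sum_comp _))
        (sum_formResultant_congr
        (fun t => if frobeniusOrbit t = A then 1 else 0)
        (fun t => if frobeniusOrbit t = B then 1 else 0) hj).symm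
      simp only [formResultant_frobenius, horb]
    convert hcard
  · intro x y hxy w
    have h0 : formResultant x.1 y.1 ≠ 0 := fun h => hxy ((formResultant_eq_zero_iff x y).1 h)
    apply Nat.cast_injective (R := ℝ)
    rw [← Finset.sum_boole]
    simp_rw [eq_comm (b := frobeniusOrbit (formResultant x.1 y.1)),
      ite_frobeniusOrbit_eq hm hF (hne1 x y) (fun h => absurd h h0)]
    rw [Finset.sum_comm, Finset.sum_congr rfl fun j _ => sum_formResultant_eq
      (pow_ne_zero _ h0) (by rw [trace_pow_two_pow, trace_formResultant]) w]
    simp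
    ring
  · intro x y hxy
    have h0 : formResultant x.1 y.1 ≠ 0 := fun h => hxy ((formResultant_eq_zero_iff x y).1 h)
    have hcard : (Finset.univ.filter fun z : EllipticPoint F =>
        frobeniusOrbit (formResultant x.1 z.1) = frobeniusOrbit (formResultant z.1 y.1)).card + 1 =
        m * (Fintype.card F + 1) := by
      apply Nat.cast_injective (R := ℝ)
      have h1 : ∀ z : EllipticPoint F, (if frobeniusOrbit (formResultant x.1 z.1) =
          frobeniusOrbit (formResultant z.1 y.1) then (1 : ℝ) else 0) =
          ∑ j ∈ Finset.range m,
            if formResultant z.1 y.1 = formResultant x.1 z.1 ^ 2 ^ j then 1 else 0 := by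
        refine fun z => ite_frobeniusOrbit_eq hm hF (hne1 x z) fun hz => ?_
        rwa [← (formResultant_eq_zero_iff x z).1 hz]
      rw [Nat.cast_add, ← Finset.sum_boole, Finset.sum_congr rfl fun z _ => h1 z, Finset.sum_comm]
      obtain ⟨m', rfl⟩ : ∃ m', m = m' + 1 := ⟨m - 1, (Nat.sub_add_cancel hm.one_le).symm⟩
      -- The term `j = 0` is split off: it contributes `q` instead of `q + 1`, which is the deficit
      -- 1 in the isosceles count.
      rw [Finset.sum_range_succ']
      have h2 : ∀ j ∈ Finset.range m', ∑ z : EllipticPoint F,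
          (if formResultant z.1 y.1 = formResultant x.1 z.1 ^ 2 ^ (j + 1)
            then (1 : ℝ) else 0) = Fintype.card F + 1 := by
        intro j hj
        exact sum_formResultant_eq_pow_of_lt hm hodd hF j.succ_pos
          (Nat.succ_lt_succ (Finset.mem_range.1 hj)) hxy
      rw [Finset.sum_congr rfl h2]
      simp only [pow_zero, pow_one, sum_formResultant_eq_self hxy]
      simp
      ring
    convert hcard

end FusionColoring

open Classical in
theorem IsPseudocyclicColoring.comp_equiv {X Y C : Type*} [Fintype X] [Fintype Y]
    {r : X → X → C} {k : ℕ} (h : IsPseudocyclicColoring r k) (e : Y ≃ X) :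
    IsPseudocyclicColoring (fun a b => r (e a) (e b)) k := by
  have hcard : ∀ (p : X → Prop) [DecidablePred p], (Finset.univ.filter fun z => p (e z)).card =
      (Finset.univ.filter p).card := fun p _ => Finset.card_equiv e (by simp)
  refine ⟨fun x y => h.symm _ _, fun x y z => ?_, fun i j x y x' y' hxy => ?_,
    fun x y hxy w => ?_, fun x y hxy => ?_⟩
  · rw [h.diag, e.apply_eq_iff_eq]
  · rw [hcard fun z => r (e x) z = i ∧ r z (e y) = j,
      hcard fun z => r (e x') z = i ∧ r z (e y') = j]
    exact h.intersection i j _ _ _ _ hxy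
  · rw [hcard fun z => r (e w) z = r (e x) (e y)]
    exact h.valency _ _ (e.injective.ne hxy) _
  · rw [hcard fun z => r (e x) z = r z (e y)]
    exact h.isosceles _ _ (e.injective.ne hxy)

/-! ### Coordinates for the exterior lines and identification of the scheme. -/

section ExteriorLines

variable {F : Type*} [Field F]

theorem mem_perpLine {x y : F} {a : Fin 3 → F} :
    a ∈ perpLine x y ↔ a 0 + a 1 * x + a 2 * y = 0 := Iff.rfl

theorem exists_conic_submodule_eq (ξ : F) :
    ∃ P ∈ conic F, P.submodule = Submodule.span F {![ξ, ξ ^ 2, 1]} := by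
  have h : (![ξ, ξ ^ 2, 1] : Fin 3 → F) ≠ 0 := fun h => by simpa using congrFun h 2
  exact ⟨Projectivization.mk F _ h, Or.inl ⟨ξ, Projectivization.submodule_mk _ h⟩,
    Projectivization.submodule_mk _ h⟩

theorem exists_conic_submodule_eq_infty :
    ∃ P ∈ conic F, P.submodule = Submodule.span F {![0, 1, 0]} := by
  have h : (![0, 1, 0] : Fin 3 → F) ≠ 0 := fun h => by simpa using congrFun h 1
  exact ⟨Projectivization.mk F _ h, Or.inr (Projectivization.submodule_mk _ h),
    Projectivization.submodule_mk _ h⟩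

/-- A line is exterior if and only if it contains none of the vectors representing the conic. -/
theorem forall_conic_iff (ℓ : Submodule F (Fin 3 → F)) :
    (∀ P ∈ conic F, ¬ P.submodule ≤ ℓ) ↔
      (∀ ξ : F, ![ξ, ξ ^ 2, 1] ∉ ℓ) ∧ ![0, 1, 0] ∉ ℓ := by
  constructor
  · intro h
    constructor
    · intro ξ hξ
      obtain ⟨P, hP, hP'⟩ := exists_conic_submodule_eq ξ
      exact h P hP (by rw [hP', Submodule.span_singleton_le_iff_mem]; exact hξ)
    · intro h0
      obtain ⟨P, hP, hP'⟩ := exists_conic_submodule_eq_infty (F := F)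
      exact h P hP (by rw [hP', Submodule.span_singleton_le_iff_mem]; exact h0)
  · rintro ⟨h1, h2⟩ P (⟨ξ, hP⟩ | hP) hle
    · rw [hP, Submodule.span_singleton_le_iff_mem] at hle
      exact h1 ξ hle
    · rw [hP, Submodule.span_singleton_le_iff_mem] at hle
      exact h2 hle

theorem finrank_ker_of_ne_zero {f : (Fin 3 → F) →ₗ[F] F} (hf : f ≠ 0) :
    Module.finrank F (LinearMap.ker f) = 2 := by
  have h1 := LinearMap.finrank_range_add_finrank_ker f
  have h2 : LinearMap.range f = ⊤ := LinearMap.range_eq_top.2 (LinearMap.surjective hf)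
  rw [h2, finrank_top, Module.finrank_self, Module.finrank_fin_fun] at h1
  omega

/-- The functional `a ↦ a₀ + a₁ x + a₂ y`. -/
def perpFunctional (x y : F) : (Fin 3 → F) →ₗ[F] F :=
  LinearMap.proj 0 + x • LinearMap.proj 1 + y • LinearMap.proj 2

theorem ker_perpFunctional (x y : F) : LinearMap.ker (perpFunctional x y) = perpLine x y := by
  ext a
  simp [perpFunctional, mem_perpLine, mul_comm]

theorem finrank_perpLine (x y : F) : Module.finrank F (perpLine x y) = 2 := by
  rw [← ker_perpFunctional]
  refine finrank_ker_of_ne_zero fun h => ?_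
  have := LinearMap.congr_fun h ![1, 0, 0]
  simp [perpFunctional] at this

variable [Fintype F] [Algebra (ZMod 2) F]

theorem perpLine_injective {x y z u : F} (h : perpLine x y = perpLine z u) : (x, y) = (z, u) := by
  have := charTwo_of_algebra F
  have h1 : (![x, 1, 0] : Fin 3 → F) ∈ perpLine z u := by
    rw [← h, mem_perpLine]
    simp [CharTwo.add_self_eq_zero]
  have h2 : (![y, 0, 1] : Fin 3 → F) ∈ perpLine z u := by
    rw [← h, mem_perpLine]
    simp [CharTwo.add_self_eq_zero]
  rw [mem_perpLine] at h1 h2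
  simp [CharTwo.add_eq_zero] at h1 h2
  rw [h1, h2]

/-- Multiplying `ξ + ξ² x + y = 0` by `x` gives `(xξ)² + xξ = xy`, which is solvable if and only if
`Tr(xy) = 0`; the point `(0, 1, 0)` accounts for `x = 0`. -/
theorem perpLine_exterior_iff (x y : F) :
    (∀ P ∈ conic F, ¬ P.submodule ≤ perpLine x y) ↔ Algebra.trace (ZMod 2) F (x * y) = 1 := by
  have h2 := two_eq_zero_of_algebra F
  rw [forall_conic_iff]
  simp only [mem_perpLine]
  simp only [Matrix.cons_val, zero_mul, one_mul, zero_add, add_zero]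
  constructor
  · rintro ⟨h, hx⟩
    refine (zmodTwo_eq_zero_or_one _).resolve_left fun h0 => ?_
    obtain ⟨u, hu⟩ := (trace_eq_zero_iff _).1 h0
    apply h (u / x)
    field_simp
    linear_combination hu + x * y * h2
  · intro h
    constructor
    · intro ξ hξ
      have : Algebra.trace (ZMod 2) F (x * y) = 0 :=
        (trace_eq_zero_iff _).2 ⟨x * ξ, by linear_combination x * hξ - x * y * h2⟩
      rw [this] at h
      exact zero_ne_one h
    · rintro rfl
      rw [zero_mul, map_zero] at h
      exact zero_ne_one h

theorem ExteriorLine.exists_eq_perpLine (ℓ : ExteriorLine F) : ∃ x y : F, ℓ.1 = perpLine x y := by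
  have := charTwo_of_algebra F
  obtain ⟨ℓ, hrank, hext⟩ := ℓ
  rw [forall_conic_iff] at hext
  have hlt : ℓ < ⊤ := by
    rw [lt_top_iff_ne_top]
    rintro rfl
    rw [finrank_top, Module.finrank_fin_fun] at hrank
    omega
  obtain ⟨f, hf, hle⟩ := Submodule.exists_le_ker_of_lt_top ℓ hlt
  have hker : ℓ = LinearMap.ker f :=
    Submodule.eq_of_le_of_finrank_eq hle (by rw [hrank, finrank_ker_of_ne_zero hf])
  have hfa : ∀ a : Fin 3 → F, f a = a 0 * f ![1, 0, 0] + a 1 * f ![0, 1, 0] +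
      a 2 * f ![0, 0, 1] := by
    intro a
    have : a = a 0 • ![1, 0, 0] + a 1 • ![0, 1, 0] + a 2 • ![0, 0, 1] := by
      ext i
      fin_cases i <;> simp
    conv_lhs => rw [this]
    simp only [map_add, map_smul, smul_eq_mul]
  have h1 : f ![0, 1, 0] ≠ 0 := fun h => hext.2 (by rw [hker]; exact h)
  -- Every line through the nucleus `(1, 0, 0)` meets the conic, since squaring is surjective.
  have h0 : f ![1, 0, 0] ≠ 0 := by
    intro h0
    obtain ⟨ξ, hξ⟩ := (bijective_sq (F := F)).2 (f ![0, 0, 1] / f ![0, 1, 0])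
    apply hext.1 ξ
    have hξ' : ξ ^ 2 = f ![0, 0, 1] / f ![0, 1, 0] := hξ
    rw [hker, LinearMap.mem_ker, hfa]
    simp only [Matrix.cons_val, h0, hξ', mul_zero, zero_add, one_mul]
    rw [div_mul_cancel₀ _ h1]
    exact CharTwo.add_self_eq_zero _
  refine ⟨f ![0, 1, 0] / f ![1, 0, 0], f ![0, 0, 1] / f ![1, 0, 0], ?_⟩
  ext a
  change a ∈ ℓ ↔ _
  rw [hker, LinearMap.mem_ker, hfa, mem_perpLine]
  field_simp
  rw [mul_zero]

variable (F) in
/-- The exterior lines correspond to the pairs `(x, y)` with `Tr(x y) = 1`. -/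
noncomputable def ellipticPointEquiv : EllipticPoint F ≃ ExteriorLine F :=
  Equiv.ofBijective
    (fun p => ⟨perpLine p.1.1 p.1.2, finrank_perpLine _ _, (perpLine_exterior_iff _ _).2 p.2⟩) <| by
    constructor
    · intro p p' h
      exact Subtype.ext (perpLine_injective (congrArg Subtype.val h))
    · intro ℓ
      obtain ⟨x, y, h⟩ := ℓ.exists_eq_perpLine
      have h2 := ℓ.2.2
      rw [h, perpLine_exterior_iff] at h2
      exact ⟨⟨(x, y), h2⟩, Subtype.ext h.symm⟩

theorem ellipticPointEquiv_val (p : EllipticPoint F) :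
    (ellipticPointEquiv F p).1 = perpLine p.1.1 p.1.2 := rfl

/-- The resultant of the forms belonging to two exterior lines. -/
noncomputable def lineResultant (ℓ ℓ' : ExteriorLine F) : F :=
  formResultant ((ellipticPointEquiv F).symm ℓ).1 ((ellipticPointEquiv F).symm ℓ').1

theorem mem_ellipticRel (a : F) (ℓ ℓ' : ExteriorLine F) :
    (ℓ, ℓ') ∈ ellipticRel a ↔ lineResultant ℓ ℓ' = a := by
  obtain ⟨p, rfl⟩ := (ellipticPointEquiv F).surjective ℓ
  obtain ⟨p', rfl⟩ := (ellipticPointEquiv F).surjective ℓ'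
  rw [lineResultant, Equiv.symm_apply_apply, Equiv.symm_apply_apply]
  constructor
  · rintro ⟨x, y, z, u, h1, h2, rfl⟩
    have h3 := perpLine_injective ((ellipticPointEquiv_val p).symm.trans h1)
    have h4 := perpLine_injective ((ellipticPointEquiv_val p').symm.trans h2)
    simp only [Prod.mk.injEq] at h3 h4
    rw [formResultant, h3.1, h3.2, h4.1, h4.2]
  · intro h
    exact ⟨_, _, _, _, ellipticPointEquiv_val p, ellipticPointEquiv_val p', h⟩

theorem mem_fusionRel {m : ℕ} (hm : 0 < m) (hF : Fintype.card F = 2 ^ m) (a : F)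
    (ℓ ℓ' : ExteriorLine F) :
    (ℓ, ℓ') ∈ fusionRel a ↔ frobeniusOrbit (lineResultant ℓ ℓ') = frobeniusOrbit a := by
  rw [eq_comm, frobeniusOrbit_eq_iff hm hF, fusionRel, Set.mem_iUnion]
  simp_rw [mem_ellipticRel]
  constructor
  · rintro ⟨i, hi⟩
    exact exists_lt_of_mem_frobeniusOrbit hm hF ⟨i, hi.symm⟩
  · rintro ⟨j, -, hj⟩
    exact ⟨j, hj⟩

theorem fusionScheme_eq_colorClasses {m : ℕ} (hm : m.Prime) (hF : Fintype.card F = 2 ^ m) :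
    fusionScheme F =
      colorClasses fun ℓ ℓ' : ExteriorLine F => frobeniusOrbit (lineResultant ℓ ℓ') := by
  classical
  have hzero : ∀ ℓ ℓ' : ExteriorLine F, lineResultant ℓ ℓ' = 0 ↔ ℓ = ℓ' := fun ℓ ℓ' => by
    rw [lineResultant, formResultant_eq_zero_iff, Equiv.apply_eq_iff_eq]
  have horb : ∀ a : F, frobeniusOrbit a = frobeniusOrbit 0 ↔ a = 0 := by
    intro a
    constructor
    · intro h
      obtain ⟨j, -, hj⟩ := (frobeniusOrbit_eq_iff hm.pos hF).1 h.symm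
      rw [hj, zero_pow (by positivity)]
    · rintro rfl
      rfl
  have hpos : 0 < Fintype.card (EllipticPoint F) := by
    have h1 := card_ellipticPoint (F := F)
    have h2 : (1 : ℝ) < Fintype.card F := by exact_mod_cast Fintype.one_lt_card
    have h3 : (0 : ℝ) < Fintype.card (EllipticPoint F) := by
      rw [h1]
      have : (0 : ℝ) < Fintype.card F - 1 := by linarith
      positivity
    exact_mod_cast h3
  obtain ⟨p⟩ := Fintype.card_pos_iff.1 hpos
  have hdiag : Set.diagonal (ExteriorLine F) = {q | frobeniusOrbit (lineResultant q.1 q.2) =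
      frobeniusOrbit 0} := by
    ext ⟨ℓ, ℓ'⟩
    simp [horb, hzero]
  have hrel : ∀ a : F, fusionRel a = {q : ExteriorLine F × ExteriorLine F |
      frobeniusOrbit (lineResultant q.1 q.2) = frobeniusOrbit a} := by
    intro a
    ext ⟨ℓ, ℓ'⟩
    exact mem_fusionRel hm.pos hF a ℓ ℓ'
  ext R
  simp only [fusionScheme, colorClasses, Set.mem_insert_iff, Set.mem_ofPred_eq, hdiag, hrel]
  constructor
  · rintro (rfl | ⟨a, ha, htr, rfl⟩)
    · refine ⟨ellipticPointEquiv F p, ellipticPointEquiv F p, ?_⟩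
      rw [(hzero _ _).2 rfl]
    · have h1 := sum_formResultant_eq ha htr p
      -- The positive valency `q + 1` ensures that every nonzero `a` of trace 0 really occurs, so no
      -- listed relation is empty.
      have h2 : ∃ z : EllipticPoint F, formResultant p.1 z.1 = a := by
        by_contra! hcon
        rw [Finset.sum_eq_zero fun z _ => if_neg (hcon z)] at h1
        have : (0 : ℝ) < Fintype.card F + 1 := by positivity
        linarith
      obtain ⟨z, hz⟩ := h2
      refine ⟨ellipticPointEquiv F p, ellipticPointEquiv F z, ?_⟩
      rw [lineResultant, Equiv.symm_apply_apply, Equiv.symm_apply_apply, hz]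
  · rintro ⟨ℓ, ℓ', rfl⟩
    by_cases h : ℓ = ℓ'
    · left
      rw [(hzero _ _).2 h]
    · right
      exact ⟨lineResultant ℓ ℓ', fun h0 => h ((hzero _ _).1 h0), trace_formResultant _ _, rfl⟩

end ExteriorLines

theorem mainTheorem3 (m q : ℕ) (hm : m.Prime) (hodd : Odd m) (hq : q = 2 ^ m)
    (F : Type*) [Field F] [Fintype F] [Algebra (ZMod 2) F] (hF : Fintype.card F = q) :
    IsPseudocyclic (fusionScheme F) ∧
    ∃ v k l μ : ℕ,
      (v : ℚ) = (q : ℚ) ^ 2 * ((q : ℚ) - 1) ^ 2 / 4 ∧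
      (k : ℚ) = m * (q + 1) * ((q : ℚ) * (q - 1) / 2 - 1) ∧
      (l : ℚ) = (q : ℚ) * (q - 1) / 2 + (m : ℚ) ^ 2 * (q + 1) ^ 2 - 3 * m * (q + 1) ∧
      (μ : ℚ) = (m : ℚ) ^ 2 * (q + 1) ^ 2 - m * (q + 1) ∧
      IsLatinSquareTypeSRG (productGraph (fusionScheme F)) v k l μ := by
  classical
  have hF2 : Fintype.card F = 2 ^ m := hF.trans hq
  have hcol := (isPseudocyclicColoring_formResultant hm hodd hF2).comp_equiv
    (ellipticPointEquiv F).symm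
  change IsPseudocyclicColoring (fun ℓ ℓ' : ExteriorLine F =>
    frobeniusOrbit (lineResultant ℓ ℓ')) _ at hcol
  rw [hF] at hcol
  have hn : (Fintype.card (ExteriorLine F) : ℚ) = q * (q - 1) / 2 := by
    have h := card_ellipticPoint (F := F)
    rw [Fintype.card_congr (ellipticPointEquiv F), hF] at h
    exact_mod_cast h
  have hm3 : 3 ≤ m := by
    obtain ⟨j, rfl⟩ := hodd
    have := hm.two_le
    omega
  have hq8 : 8 ≤ q := by
    rw [hq]
    exact Nat.pow_le_pow_right (n := 2) (by norm_num) hm3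
  have hn1 : 1 < Fintype.card (ExteriorLine F) := by
    have h1 : (8 : ℚ) ≤ q := by exact_mod_cast hq8
    have h2 : (1 : ℚ) < Fintype.card (ExteriorLine F) := by
      rw [hn]
      nlinarith
    exact_mod_cast h2
  have : Nontrivial (ExteriorLine F) := Fintype.one_lt_card_iff_nontrivial.1 hn1
  rw [fusionScheme_eq_colorClasses hm hF2]
  have hk3 : 3 ≤ m * (q + 1) := by nlinarith
  -- This keeps the natural-number subtraction defining `λ` from truncating; it follows from `k ≥
  -- 3`, as then `3 k ≤ k²`.
  have hle : 3 * (m * (q + 1)) ≤ Fintype.card (ExteriorLine F) + (m * (q + 1)) ^ 2 := by nlinarith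
  refine ⟨hcol.isPseudocyclic, _, _,
    Fintype.card (ExteriorLine F) + (m * (q + 1)) ^ 2 - 3 * (m * (q + 1)), _, ?_, ?_, ?_, ?_,
    hcol.isLatinSquareTypeSRG ?_⟩
  · push_cast
    rw [hn]
    ring
  · rw [Nat.cast_mul, Nat.cast_sub hn1.le, hn]
    push_cast
    ring
  · rw [Nat.cast_sub hle]
    push_cast
    rw [hn]
    ring
  · rw [Nat.cast_mul, Nat.cast_sub (show 1 ≤ m * (q + 1) by omega)]
    push_cast
    ring
  · rw [Nat.cast_sub hle]
    push_cast
    ring
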